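/- Let $K$ be an algebraically closed field that is complete with respect to a non-Archimedean absolute value, with ring of integers $\mathcal O$ and residue field $k$. Put $q_v=e$ if $\mathrm{char}(k)=0$ and $q_v=\mathrm{char}(k)$ otherwise, and $\mathrm{ord}(x)=-\log_{q_v}|x|$. A lift of a rational function $\psi\in K(z)$ of degree $D$ is a pair $[F,G]$ of coprime binary forms of degree $D$ over $K$ with $\psi(z)=F(z,1)/G(z,1)$; it is normalized if the maximum of the absolute values of its $2D+2$ coefficients is $1$. Let $R_\psi=\mathrm{ord}(\mathrm{Res}(F,G))$ for any normalized lift $[F,G]$ of $\psi$, and let $R_{[\psi]}=\min_{\gamma\in \mathrm{PGL}_2(K)}R_{\psi^\gamma}$, where $\psi^\gamma=\gamma^{-1}\circ\psi\circ\gamma$. Let $A_D$ be the polynomial ring over $\mathbb Z$ in the $2D+2$ coefficients $(a,b)$ of a pair of binary forms of degree $D$, on which $\mathrm{SL}_2$ acts by conjugation of pairs of forms. A point of $\mathbb P^{2D+1}(k)$ is semistable if some homogeneous element of positive degree of the invariant ring $A_D^{\mathrm{SL}_2}$ does not vanish at it. We say that $\psi$ has semistable reduction if the coefficients of a normalized lift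 of $\psi$, reduced modulo the maximal ideal of $\mathcal O$, give a semistable point of $\mathbb P^{2D+1}(k)$. Let $\varphi\in K(z)$ have degree $d\ge 2$, and put $N_m=\dfrac{d^m(d^m-1)}{d(d-1)}$ for $m\ge 0$. Suppose that for some $n\ge 1$ the iterate $\varphi^n$ has semistable reduction and $R_{\varphi^n}=N_n\cdot R_\varphi$. Then: (1) $\varphi$ itself has semistable reduction, the minima defining $R_{[\varphi]}$ and $R_{[\varphi^n]}$ are attained, and the minimal resultant iteration formula $R_{[\varphi^n]}=N_n\cdot R_{[\varphi]}$ holds for this $n$. (2) If $n\ge 2$, then $R_{\varphi^m}=N_m\cdot R_\varphi$ for every $m\ge 0$. -/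

import Mathlib

noncomputable section

namespace RatDyn

universe u

/-! ### Pairs of binary forms of degree `d` -/

/-- The `2d+2` coefficients of a pair of binary forms of degree `d` over `R`:
`a (0, j)` and `a (1, j)` are the coefficients of `X^j Y^(d-j)` in `F` and `G`. -/
abbrev Coeffs (d : ℕ) (R : Type*) := Fin 2 × Fin (d + 1) → R

/-- The dehomogenized form: `F(z,1)` for `i = 0`, and `G(z,1)` for `i = 1`. -/
def coordPoly {d : ℕ} {R : Type*} [CommRing R] (a : Coeffs d R) (i : Fin 2) : Polynomial R :=
  ∑ j : Fin (d + 1), Polynomial.C (a (i, j)) * Polynomial.X ^ (j : ℕ)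

/-- The resultant form `ρ_d`: the resultant `Res(F, G)` of two binary forms of degree `d`
(the determinant of their `2d × 2d` Sylvester matrix). -/
def resForm {d : ℕ} {R : Type*} [CommRing R] (a : Coeffs d R) : R :=
  Polynomial.resultant (coordPoly a 0) (coordPoly a 1) d d

/-- The action of `SL₂` by conjugation on pairs of forms `Φ = (F, G)`: the coefficients of
`g⁻¹ ∘ Φ ∘ g`. Forms are written dehomogenized (`X = z`, `Y = 1`), so `F(g (X, Y))` is
`∑ a_j (αz+β)^j (γz+δ)^(d-j)`. -/
def conjCoeffs {d : ℕ} {R : Type*} [CommRing R]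
    (g : Matrix.SpecialLinearGroup (Fin 2) R) (a : Coeffs d R) : Coeffs d R :=
  let L : Fin 2 → Polynomial R := fun i =>
    Polynomial.C (g.1 i 0) * Polynomial.X + Polynomial.C (g.1 i 1)
  let P : Fin 2 → Polynomial R := fun i =>
    ∑ j : Fin (d + 1), Polynomial.C (a (i, j)) * L 0 ^ (j : ℕ) * L 1 ^ (d - (j : ℕ))
  fun ij => (∑ l : Fin 2, Polynomial.C (g⁻¹.1 ij.1 l) * P l).coeff (ij.2 : ℕ)

/-! ### Semistable points -/

/-- `H ∈ A_d = ℤ[a, b]` is invariant under the group scheme `SL₂` over `ℤ`: it is invariant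
under `SL₂(R)` on `R`-valued coefficients, for every commutative ring `R`. (The condition does
not depend on the universe `u`: the universal case is the countable ring
`ℤ[a, b][α, β, γ, δ]/(αδ - βγ - 1)`.) -/
def IsSL2Invariant {d : ℕ} (H : MvPolynomial (Fin 2 × Fin (d + 1)) ℤ) : Prop :=
  ∀ (R : Type u) [CommRing R] (g : Matrix.SpecialLinearGroup (Fin 2) R) (a : Coeffs d R),
    MvPolynomial.aeval (conjCoeffs g a) H = MvPolynomial.aeval a H

/-- A point of `ℙ^{2d+1}(k)` is semistable if it lies outside the indeterminacy locus of the
rational map `Proj A_d ⇢ Proj A_d^{SL₂}`, that is, if some homogeneous `SL₂`-invariant form of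
positive degree does not vanish at it. -/
def IsSemistable {d : ℕ} {k : Type u} [Field k] (a : Coeffs d k) : Prop :=
  ∃ (D : ℕ) (H : MvPolynomial (Fin 2 × Fin (d + 1)) ℤ), 0 < D ∧ H.IsHomogeneous D ∧
    IsSL2Invariant.{u} H ∧ MvPolynomial.aeval a H ≠ 0

/-! ### Rational functions: composition, iterates, conjugates, degree, lifts -/

section Field

variable {K : Type*} [Field K]

/-- The composition `φ ∘ ψ` (used only for non-constant `ψ`). -/
def comp (φ ψ : RatFunc K) : RatFunc K := RatFunc.eval RatFunc.C ψ φ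

/-- The `n`-th iterate `φ^n = φ ∘ ⋯ ∘ φ`. -/
def iter (φ : RatFunc K) : ℕ → RatFunc K
  | 0 => RatFunc.X
  | n + 1 => comp φ (iter φ n)

/-- The Möbius transformation `z ↦ (αz+β)/(γz+δ)` given by a matrix. -/
def mobius (γ : Matrix.GeneralLinearGroup (Fin 2) K) : RatFunc K :=
  (RatFunc.C (γ.1 0 0) * RatFunc.X + RatFunc.C (γ.1 0 1)) /
    (RatFunc.C (γ.1 1 0) * RatFunc.X + RatFunc.C (γ.1 1 1))

/-- The conjugate `φ^γ = γ⁻¹ ∘ φ ∘ γ`. -/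
def conj (φ : RatFunc K) (γ : Matrix.GeneralLinearGroup (Fin 2) K) : RatFunc K :=
  comp (mobius γ⁻¹) (comp φ (mobius γ))

/-- The degree of a rational function. -/
def degree (φ : RatFunc K) : ℕ := max φ.num.natDegree φ.denom.natDegree

/-- `a` is the coefficient vector of a homogeneous lift `[F, G]` of `φ`: the forms `F, G` are
coprime (nonzero resultant) and `φ(z) = F(z,1)/G(z,1)`. Then `d` is the degree of `φ`, see
`IsLift.eq_smul` below. -/
def IsLift {d : ℕ} (φ : RatFunc K) (a : Coeffs d K) : Prop :=
  resForm a ≠ 0 ∧ coordPoly a 1 ≠ 0 ∧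
    φ = algebraMap (Polynomial K) (RatFunc K) (coordPoly a 0) /
      algebraMap (Polynomial K) (RatFunc K) (coordPoly a 1)

end Field

/-! ### Normalized lifts and the resultant over a non-Archimedean field -/

section NonArch

variable {K : Type u} [NormedField K] [IsUltrametricDist K]

/-- The ring of integers `{x : |x| ≤ 1}`. -/
abbrev Integers (K : Type u) [NormedField K] [IsUltrametricDist K] : ValuationSubring K :=
  (NormedField.valuation (K := K)).valuationSubring

/-- The residue field `k`. -/
abbrev Residue (K : Type u) [NormedField K] [IsUltrametricDist K] : Type u :=
  IsLocalRing.ResidueField (Integers K)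

/-- The base `q_v`: `e` if `char k = 0`, and `char k` otherwise. -/
def logBase (K : Type u) [NormedField K] [IsUltrametricDist K] : ℝ :=
  if ringChar (Residue K) = 0 then Real.exp 1 else (ringChar (Residue K) : ℝ)

/-- `ord x = -log_{q_v} |x|` (for `x ≠ 0`). -/
def ord (x : K) : ℝ := -Real.logb (logBase K) ‖x‖

/-- A normalized lift of `φ`: a lift whose coefficients lie in the ring of integers, at least
one of them having absolute value `1`. -/
def IsNormalizedLift {d : ℕ} (φ : RatFunc K) (a : Coeffs d (Integers K)) : Prop :=
  IsLift φ (fun ij => (a ij : K)) ∧ ∃ ij, ‖(a ij : K)‖ = 1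

/-- The coefficients reduced modulo the maximal ideal. -/
def reduce {d : ℕ} (a : Coeffs d (Integers K)) : Coeffs d (Residue K) :=
  fun ij => IsLocalRing.residue (Integers K) (a ij)

/-- `φ` has semistable reduction: the reduction `φ_v` of `φ`, a point of `ℙ^{2d+1}(k)`, is
semistable. -/
def HasSemistableReduction (φ : RatFunc K) : Prop :=
  ∃ (d : ℕ) (a : Coeffs d (Integers K)), IsNormalizedLift φ a ∧ IsSemistable (reduce a)

end NonArch

/-! ### Every rational function has a normalized lift, and it is unique up to scaling -/

section Lifts

lemma coeff_coordPoly {d : ℕ} {R : Type*} [CommRing R] (a : Coeffs d R) (i : Fin 2)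
    (j : Fin (d + 1)) : (coordPoly a i).coeff (j : ℕ) = a (i, j) := by
  simp only [coordPoly, Polynomial.finsetSum_coeff, Polynomial.coeff_C_mul,
    Polynomial.coeff_X_pow]
  rw [Finset.sum_eq_single j]
  · simp
  · intro b _ hb
    have : (j : ℕ) ≠ b := fun h => hb (Fin.ext h.symm)
    simp [this]
  · simp

lemma natDegree_coordPoly_le {d : ℕ} {R : Type*} [CommRing R] (a : Coeffs d R) (i : Fin 2) :
    (coordPoly a i).natDegree ≤ d := by
  refine Polynomial.natDegree_sum_le_of_forall_le _ _ fun j _ => ?_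
  exact (Polynomial.natDegree_C_mul_X_pow_le _ _).trans (by omega)

lemma coordPoly_of_coeff {d : ℕ} {R : Type*} [CommRing R] (p : Fin 2 → Polynomial R)
    (i : Fin 2) (h : (p i).natDegree ≤ d) :
    coordPoly (d := d) (fun ij => (p ij.1).coeff (ij.2 : ℕ)) i = p i := by
  conv_rhs => rw [(p i).as_sum_range_C_mul_X_pow' (Nat.lt_succ_of_le h)]
  rw [Finset.sum_range]
  rfl

variable {K : Type u}

/-- A lift of `φ` has the degree of `φ`, and is a multiple of `[num φ, denom φ]`. -/
lemma IsLift.eq_smul [Field K] {d : ℕ} {φ : RatFunc K} {a : Coeffs d K} (h : IsLift φ a) :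
    d = degree φ ∧ ∃ c : K, c ≠ 0 ∧ coordPoly a 0 = Polynomial.C c * φ.num ∧
      coordPoly a 1 = Polynomial.C c * φ.denom := by
  obtain ⟨hr, hG, hφ⟩ := h
  set F := coordPoly a 0 with hF'
  set G := coordPoly a 1 with hG'
  have hFd : F.natDegree ≤ d := natDegree_coordPoly_le a 0
  have hGd : G.natDegree ≤ d := natDegree_coordPoly_le a 1
  have hcop : IsCoprime F G := by
    rcases Nat.eq_zero_or_pos d with hd | hd
    · have hu : IsUnit G := by
        rw [Polynomial.isUnit_iff_degree_eq_zero, Polynomial.degree_eq_natDegree hG]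
        have : G.natDegree = 0 := by omega
        simp [this]
      obtain ⟨v, hv⟩ := hu.exists_left_inv
      exact ⟨0, v, by simp [hv]⟩
    · obtain ⟨p, q, -, -, e⟩ := Polynomial.exists_mul_add_mul_eq_C_resultant F G hFd hGd
        (Or.inl hd.ne')
      refine ⟨Polynomial.C (resForm a)⁻¹ * p, Polynomial.C (resForm a)⁻¹ * q, ?_⟩
      have e2 : F * p + G * q = Polynomial.C (resForm a) := e
      have e3 : Polynomial.C (resForm a)⁻¹ * Polynomial.C (resForm a) = (1 : Polynomial K) := by
        rw [← Polynomial.C_mul, inv_mul_cancel₀ hr, Polynomial.C_1]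
      linear_combination Polynomial.C (resForm a)⁻¹ * e2 + e3
  have hGne : algebraMap (Polynomial K) (RatFunc K) G ≠ 0 := by
    simpa using hG
  have hdne : algebraMap (Polynomial K) (RatFunc K) φ.denom ≠ 0 := by
    simpa using φ.denom_ne_zero
  have hcross : φ.num * G = F * φ.denom := by
    apply RatFunc.algebraMap_injective K
    rw [map_mul, map_mul]
    have := φ.num_div_denom
    rw [hφ] at this
    rw [← hφ] at this
    rw [← div_eq_div_iff hdne hGne, this]
    exact hφ
  have hd1 : φ.denom ∣ G := by
    refine (φ.isCoprime_num_denom.symm).dvd_of_dvd_mul_left ?_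
    exact ⟨F, by rw [hcross]; ring⟩
  have hd2 : G ∣ φ.denom := by
    refine (hcop.symm).dvd_of_dvd_mul_left ?_
    exact ⟨φ.num, by rw [← hcross]; ring⟩
  obtain ⟨w, hw⟩ := associated_of_dvd_dvd hd1 hd2
  obtain ⟨c, hc, hcw⟩ := Polynomial.isUnit_iff.1 w.isUnit
  have hG2 : G = Polynomial.C c * φ.denom := by rw [← hw, ← hcw]; ring
  have hF2 : F = Polynomial.C c * φ.num := by
    apply mul_right_cancel₀ φ.denom_ne_zero
    rw [← hcross, hG2]; ring
  have hc0 : c ≠ 0 := hc.ne_zero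
  refine ⟨?_, c, hc0, hF2, hG2⟩
  have e1 : F.natDegree = φ.num.natDegree := by
    rw [hF2, Polynomial.natDegree_C_mul hc0]
  have e2 : G.natDegree = φ.denom.natDegree := by
    rw [hG2, Polynomial.natDegree_C_mul hc0]
  have : ¬ (F.natDegree < d ∧ G.natDegree < d) := fun hlt =>
    hr (Polynomial.resultant_eq_zero_of_lt_lt _ _ _ _ hlt.1 hlt.2)
  unfold degree
  omega

lemma exists_isNormalizedLift [NormedField K] [IsUltrametricDist K] (φ : RatFunc K) :
    ∃ a : Coeffs (degree φ) (Integers K), IsNormalizedLift φ a := by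
  classical
  set p : Fin 2 → Polynomial K := ![φ.num, φ.denom] with hp
  let b : Coeffs (degree φ) K := fun ij => (p ij.1).coeff (ij.2 : ℕ)
  have hb0 : coordPoly b 0 = φ.num := coordPoly_of_coeff p 0 (le_max_left _ _)
  have hb1 : coordPoly b 1 = φ.denom := coordPoly_of_coeff p 1 (le_max_right _ _)
  obtain ⟨m, hm⟩ := Finite.exists_max (fun ij => ‖b ij‖)
  have hm0 : b m ≠ 0 := by
    intro h0
    apply φ.denom_ne_zero
    rw [← hb1]
    have : ∀ ij, b ij = 0 := fun ij => by
      have := hm ij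
      rw [h0, norm_zero] at this
      exact norm_le_zero_iff.1 this
    simp [coordPoly, this]
  have hle : ∀ ij, ‖b ij / b m‖ ≤ 1 := fun ij => by
    rw [norm_div]
    exact div_le_one_of_le₀ (hm ij) (norm_nonneg _)
  refine ⟨fun ij => ⟨b ij / b m, ?_⟩, ⟨?_, ?_, ?_⟩, m, ?_⟩
  · rw [Valuation.mem_valuationSubring_iff]
    exact_mod_cast hle ij
  · have hs : ∀ i, coordPoly (fun ij => b ij / b m) i =
        Polynomial.C (b m)⁻¹ * coordPoly b i := fun i => by
      simp only [coordPoly, Finset.mul_sum, div_eq_mul_inv, Polynomial.C_mul]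
      exact Finset.sum_congr rfl fun j _ => by ring
    change Polynomial.resultant (coordPoly (fun ij => b ij / b m) 0)
      (coordPoly (fun ij => b ij / b m) 1) _ _ ≠ 0
    rw [hs, hs, Polynomial.resultant_C_mul_left, Polynomial.resultant_C_mul_right, hb0, hb1]
    refine mul_ne_zero (pow_ne_zero _ (inv_ne_zero hm0))
      (mul_ne_zero (pow_ne_zero _ (inv_ne_zero hm0)) ?_)
    have key := Polynomial.resultant_ne_zero _ _ φ.isCoprime_num_denom
    rcases le_total φ.num.natDegree φ.denom.natDegree with h | h
    · obtain ⟨t, ht⟩ := Nat.exists_eq_add_of_le h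
      have hdeg : degree φ = φ.denom.natDegree := max_eq_right h
      have := Polynomial.resultant_add_left_deg φ.num φ.denom φ.num.natDegree
        φ.denom.natDegree t le_rfl
      rw [hdeg]
      rw [← ht] at this
      rw [this]
      refine mul_ne_zero (mul_ne_zero ?_ ?_) key
      · exact pow_ne_zero _ (by simp)
      · exact pow_ne_zero _ (by simpa using φ.denom_ne_zero)
    · obtain ⟨t, ht⟩ := Nat.exists_eq_add_of_le h
      have hdeg : degree φ = φ.num.natDegree := max_eq_left h
      rcases eq_or_ne φ.num 0 with h0 | h0
      · have h1 : φ.denom.natDegree = 0 := by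
          have : φ.num.natDegree = 0 := by simp [h0]
          omega
        have : degree φ = 0 := by rw [hdeg]; simp [h0]
        rw [this]
        simp
      have := Polynomial.resultant_add_right_deg φ.num φ.denom φ.num.natDegree
        φ.denom.natDegree t le_rfl
      rw [hdeg]
      rw [← ht] at this
      rw [this]
      refine mul_ne_zero ?_ key
      exact pow_ne_zero _ (by simpa using h0)
  · intro h
    have h2 := congrArg (fun q => Polynomial.C (b m) * q) h
    have hs : Polynomial.C (b m) * coordPoly (fun ij => b ij / b m) 1 = coordPoly b 1 := by
      simp only [coordPoly, Finset.mul_sum, ← mul_assoc, ← Polynomial.C_mul,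
        mul_div_cancel₀ _ hm0]
    apply φ.denom_ne_zero
    rw [← hb1, ← hs]
    simpa using h2
  · have hs : ∀ i, coordPoly (fun ij => b ij / b m) i =
        Polynomial.C (b m)⁻¹ * coordPoly b i := fun i => by
      simp only [coordPoly, Finset.mul_sum, div_eq_mul_inv, Polynomial.C_mul]
      exact Finset.sum_congr rfl fun j _ => by ring
    change φ = algebraMap _ _ (coordPoly (fun ij => b ij / b m) 0) /
      algebraMap _ _ (coordPoly (fun ij => b ij / b m) 1)
    rw [hs, hs, hb0, hb1, map_mul, map_mul, mul_div_mul_left, φ.num_div_denom]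
    simpa using hm0
  · change ‖b m / b m‖ = 1
    rw [div_self hm0, norm_one]

end Lifts

/-! ### The resultant of a rational map -/

section Resultant

variable {K : Type u} [NormedField K] [IsUltrametricDist K]

/-- `R_φ`: the `ord` value of the resultant of a normalized lift of `φ`. It does not depend on
the normalized lift, see `ordRes_eq` below. -/
def ordRes (φ : RatFunc K) : ℝ :=
  ord (resForm (fun ij => ((exists_isNormalizedLift φ).choose ij : K)))

lemma ordRes_eq {d : ℕ} {φ : RatFunc K} {a : Coeffs d (Integers K)}
    (h : IsNormalizedLift φ a) : ordRes φ = ord (resForm (fun ij => (a ij : K))) := by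
  obtain ⟨hd, -⟩ := h.1.eq_smul
  subst hd
  obtain ⟨-, c, hc, hF, hG⟩ := h.1.eq_smul
  have h' := (exists_isNormalizedLift φ).choose_spec
  obtain ⟨-, c', hc', hF', hG'⟩ := h'.1.eq_smul
  set b := (exists_isNormalizedLift φ).choose
  have hco : ∀ ij, (a ij : K) = c * (![φ.num, φ.denom] ij.1).coeff (ij.2 : ℕ) := by
    rintro ⟨i, j⟩
    rw [← coeff_coordPoly (fun ij => (a ij : K)) i j]
    fin_cases i
    · simp [hF]
    · simp [hG]
  have hco' : ∀ ij, (b ij : K) = c' * (![φ.num, φ.denom] ij.1).coeff (ij.2 : ℕ) := by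
    rintro ⟨i, j⟩
    rw [← coeff_coordPoly (fun ij => (b ij : K)) i j]
    fin_cases i
    · simp [hF']
    · simp [hG']
  have hle : ∀ x : Integers K, ‖(x : K)‖ ≤ 1 := fun x => by
    have := (Valuation.mem_valuationSubring_iff _ _).1 x.2
    exact_mod_cast this
  have hcc : ‖c‖ = ‖c'‖ := by
    obtain ⟨s, hs⟩ := h.2
    obtain ⟨t, ht⟩ := h'.2
    have hs' := hle (b s)
    have ht' := hle (a t)
    rw [hco, norm_mul] at hs ht'
    rw [hco', norm_mul] at ht hs'
    have p1 : 0 < ‖c‖ := norm_pos_iff.2 hc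
    have p2 : 0 < ‖c'‖ := norm_pos_iff.2 hc'
    set x := ‖(![φ.num, φ.denom] s.1).coeff (s.2 : ℕ)‖
    set y := ‖(![φ.num, φ.denom] t.1).coeff (t.2 : ℕ)‖
    have hx : 0 < x := by
      by_contra hx
      have := mul_nonpos_of_nonneg_of_nonpos p1.le (not_lt.1 hx)
      linarith
    have hy : 0 < y := by
      by_contra hy
      have := mul_nonpos_of_nonneg_of_nonpos p2.le (not_lt.1 hy)
      linarith
    apply le_antisymm
    · exact le_of_mul_le_mul_right (ht'.trans ht.ge) hy
    · exact le_of_mul_le_mul_right (hs'.trans hs.ge) hx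
  unfold ordRes ord
  congr 2
  unfold resForm
  rw [hF, hG, hF', hG']
  simp only [Polynomial.resultant_C_mul_left, Polynomial.resultant_C_mul_right, norm_mul,
    norm_pow, hcc]

/-- `r` is the minimal resultant `R_[φ]`: the minimum of `R_{φ^γ}` over all conjugates of `φ`
by elements `γ` of `PGL₂(K)` (given by matrices in `GL₂(K)`). -/
def IsMinimalResultant (φ : RatFunc K) (r : ℝ) : Prop :=
  IsLeast (Set.range fun γ : Matrix.GeneralLinearGroup (Fin 2) K => ordRes (conj φ γ)) r

/-- The number `N = d^n (d^n - 1) / (d (d - 1))`. -/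
def iterExponent (d n : ℕ) : ℝ :=
  ((d : ℝ) ^ n * ((d : ℝ) ^ n - 1)) / ((d : ℝ) * ((d : ℝ) - 1))

end Resultant

end RatDyn

end

/-!
Conjugation by `GL₂` and homogeneous iteration `Φ ↦ Φⁿ` act on the coefficients of a pair of binary
forms, and iteration commutes with conjugation by `SL₂`; so an invariant that does not vanish at
`Φⁿ` pulls back to an invariant that does not vanish at `Φ`. An invariant takes a value of absolute
value `1` on a normalized lift with semistable reduction, and its values on the conjugates of that
lift are known; this bounds from below the largest coefficient of any conjugate, which is the
minimality of the resultant.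

The resultant of a composition gives `Res(Φⁿ) = Res(Φ) ^ N_n`. Hence `R_{φⁿ} = N_n R_φ` holds
exactly when the `n`-th iterate of a normalized lift of `φ` is again normalized, that is, when the
`n`-th iterate of its reduction does not vanish. Over the residue field, the two forms of a pair are
either linearly independent, and then no iterate vanishes, or of the form `w A` with a constant
vector `w`. In the second case no iterate vanishes if `A(w) ≠ 0`, and all iterates from the second
on vanish if `A(w) = 0`.
-/

noncomputable section

namespace RatDyn

universe u

open Polynomial
open scoped MatrixGroups

/-! ### Values of binary forms -/

section

variable {σ R S : Type*} [CommRing R] [CommRing S] [Algebra R S]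

lemma aeval_smul_of_isHomogeneous {D : ℕ} {H : MvPolynomial σ R} (hH : H.IsHomogeneous D)
    (c : S) (x : σ → S) : MvPolynomial.aeval (c • x) H = c ^ D * MvPolynomial.aeval x H := by
  simp only [MvPolynomial.aeval_def, MvPolynomial.eval₂_eq, Finset.mul_sum]
  refine Finset.sum_congr rfl fun m hm => ?_
  have hdeg : ∑ i ∈ m.support, m i = D := by
    rw [← Finsupp.degree_apply, Finsupp.degree_eq_weight_one]
    exact hH (MvPolynomial.mem_support_iff.1 hm)
  simp only [Pi.smul_apply, smul_eq_mul, mul_pow, Finset.prod_mul_distrib,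
    Finset.prod_pow_eq_pow_sum, hdeg]
  ring

/-- The value at `x` of the binary form of degree `d` whose dehomogenization is `f`, that is
`∑ f_j x₀ ^ j x₁ ^ (d - j)`. -/
def formEval (d : ℕ) (f : R[X]) (x : Fin 2 → S) : S :=
  MvPolynomial.aeval x (f.homogenize d)

lemma formEval_eq_sum (d : ℕ) (f : R[X]) (x : Fin 2 → S) :
    formEval d f x =
      ∑ j ∈ Finset.range (d + 1), algebraMap R S (f.coeff j) * x 0 ^ j * x 1 ^ (d - j) := by
  rw [formEval, homogenize, map_sum, Finset.Nat.sum_antidiagonal_eq_sum_range_succ_mk]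
  refine Finset.sum_congr rfl fun j _ => ?_
  rw [MvPolynomial.aeval_monomial, mul_assoc, Finsupp.prod_fintype _ _ (by simp)]
  simp

lemma formEval_add (d : ℕ) (f g : R[X]) (x : Fin 2 → S) :
    formEval d (f + g) x = formEval d f x + formEval d g x := by
  simp [formEval]

lemma formEval_C_mul (d : ℕ) (c : R) (f : R[X]) (x : Fin 2 → S) :
    formEval d (C c * f) x = algebraMap R S c * formEval d f x := by
  simp [formEval]

lemma formEval_mul {d e : ℕ} {f g : R[X]} (hf : f.natDegree ≤ d) (hg : g.natDegree ≤ e)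
    (x : Fin 2 → S) : formEval (d + e) (f * g) x = formEval d f x * formEval e g x := by
  simp [formEval, homogenize_mul _ _ hf hg]

lemma formEval_zero_deg (f : R[X]) (x : Fin 2 → S) :
    formEval 0 f x = algebraMap R S (f.coeff 0) := by
  simp [formEval_eq_sum]

lemma formEval_one_deg (f : R[X]) (x : Fin 2 → S) :
    formEval 1 f x = algebraMap R S (f.coeff 1) * x 0 + algebraMap R S (f.coeff 0) * x 1 := by
  simp [formEval_eq_sum, Finset.sum_range_succ, add_comm]

lemma formEval_smul (d : ℕ) (f : R[X]) (c : S) (x : Fin 2 → S) :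
    formEval d f (c • x) = c ^ d * formEval d f x :=
  aeval_smul_of_isHomogeneous (isHomogeneous_homogenize f) c x

lemma map_formEval {T : Type*} [CommRing T] [Algebra R T] (τ : S →ₐ[R] T) (d : ℕ) (f : R[X])
    (x : Fin 2 → S) : τ (formEval d f x) = formEval d f (fun i => τ (x i)) :=
  MvPolynomial.comp_aeval_apply _ τ _

lemma polynomialMap_formEval {T : Type*} [CommRing T] (τ : R →+* T) (d : ℕ) (f : R[X])
    (x : Fin 2 → R[X]) :
    (formEval d f x).map τ = formEval d (f.map τ) (fun i => (x i).map τ) := by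
  simp [formEval_eq_sum, Polynomial.map_sum]

lemma natDegree_formEval_le {d e : ℕ} (f : R[X]) {x : Fin 2 → R[X]}
    (hx : ∀ i, (x i).natDegree ≤ e) : (formEval d f x).natDegree ≤ d * e := by
  rw [formEval_eq_sum]
  refine natDegree_sum_le_of_forall_le _ _ fun j hj => ?_
  have hjd : j + (d - j) = d := Nat.add_sub_cancel' (Finset.mem_range_succ_iff.1 hj)
  calc _ ≤ 0 + j * e + (d - j) * e :=
        natDegree_mul_le_of_le (natDegree_mul_le_of_le (natDegree_C _).le
          (natDegree_pow_le_of_le j (hx 0))) (natDegree_pow_le_of_le (d - j) (hx 1))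
    _ = d * e := by rw [zero_add, ← add_mul, hjd]

lemma homogenize_formEval {d e : ℕ} (f : R[X]) {y : Fin 2 → R[X]}
    (hy : ∀ i, (y i).natDegree ≤ e) :
    (formEval d f y).homogenize (d * e) =
      MvPolynomial.aeval (fun i => (y i).homogenize e) (f.homogenize d) := by
  refine homogenize_eq_of_isHomogeneous ?_ ?_
  · rw [mul_comm]
    exact (isHomogeneous_homogenize f).aeval _ fun i => isHomogeneous_homogenize (y i)
  · rw [MvPolynomial.comp_aeval_apply]
    simp only [aeval_homogenize_X_one _ (hy _), formEval]

lemma formEval_formEval {d e : ℕ} (f : R[X]) {y : Fin 2 → R[X]}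
    (hy : ∀ i, (y i).natDegree ≤ e) (x : Fin 2 → S) :
    formEval (d * e) (formEval d f y) x = formEval d f (fun i => formEval e (y i) x) := by
  rw [formEval, homogenize_formEval f hy, MvPolynomial.comp_aeval_apply]
  rfl

end

/-! ### Composition, iteration and conjugation of pairs of forms -/

section

variable {R : Type*} [CommRing R]

/-- The composition `p ∘ q` of dehomogenized pairs of binary forms, where `p` has degree `d`. -/
def compPair (d : ℕ) (p q : Fin 2 → R[X]) : Fin 2 → R[X] :=
  fun i => formEval d (p i) q

/-- The iterates of a dehomogenized pair of binary forms of degree `d`. The zeroth one is the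
identity `(X, Y)`, which dehomogenizes to `(X, 1)`. -/
def iterPair (d : ℕ) (p : Fin 2 → R[X]) : ℕ → Fin 2 → R[X]
  | 0 => ![X, 1]
  | n + 1 => compPair d p (iterPair d p n)

/-- The linear combinations of a pair of forms given by the rows of a matrix `g`, that is
`g ∘ p`. -/
def linPair (g : Matrix (Fin 2) (Fin 2) R) (p : Fin 2 → R[X]) : Fin 2 → R[X] :=
  fun i => C (g i 0) * p 0 + C (g i 1) * p 1

/-- The conjugate `γ⁻¹ ∘ p ∘ γ` of a dehomogenized pair of binary forms of degree `d`. -/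
def conjPair (d : ℕ) (γ : GL (Fin 2) R) (p : Fin 2 → R[X]) : Fin 2 → R[X] :=
  linPair γ⁻¹.1 (compPair d p (linPair γ.1 ![X, 1]))

lemma natDegree_X_one_le (i : Fin 2) : ((![X, 1] : Fin 2 → R[X]) i).natDegree ≤ 1 := by
  fin_cases i
  exacts [natDegree_X_le, natDegree_one.trans_le zero_le_one]

lemma natDegree_linPair_le {d : ℕ} (g : Matrix (Fin 2) (Fin 2) R) {p : Fin 2 → R[X]}
    (hp : ∀ i, (p i).natDegree ≤ d) (i : Fin 2) : (linPair g p i).natDegree ≤ d :=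
  natDegree_add_le_of_degree_le ((natDegree_C_mul_le _ _).trans (hp 0))
    ((natDegree_C_mul_le _ _).trans (hp 1))

lemma natDegree_iterPair_le (d : ℕ) (p : Fin 2 → R[X]) (n : ℕ) (i : Fin 2) :
    (iterPair d p n i).natDegree ≤ d ^ n := by
  induction n generalizing i with
  | zero => exact natDegree_X_one_le i
  | succ n ih => exact pow_succ' d n ▸ natDegree_formEval_le (p i) ih

lemma natDegree_compPair_linPair_X_one_le (d : ℕ) (g : Matrix (Fin 2) (Fin 2) R)
    (p : Fin 2 → R[X]) (i : Fin 2) : (compPair d p (linPair g ![X, 1]) i).natDegree ≤ d :=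
  (natDegree_formEval_le (p i) (natDegree_linPair_le g natDegree_X_one_le)).trans_eq (mul_one d)

lemma natDegree_conjPair_le (d : ℕ) (γ : GL (Fin 2) R) (p : Fin 2 → R[X]) (i : Fin 2) :
    (conjPair d γ p i).natDegree ≤ d :=
  natDegree_linPair_le _ (natDegree_compPair_linPair_X_one_le d γ.1 p) i

lemma compPair_assoc {d e : ℕ} (p : Fin 2 → R[X]) {q : Fin 2 → R[X]}
    (hq : ∀ i, (q i).natDegree ≤ e) (r : Fin 2 → R[X]) :
    compPair (d * e) (compPair d p q) r = compPair d p (compPair e q r) :=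
  funext fun i => formEval_formEval (p i) hq r

lemma compPair_X_one {d : ℕ} {p : Fin 2 → R[X]} (hp : ∀ i, (p i).natDegree ≤ d) :
    compPair d p ![X, 1] = p :=
  funext fun i => aeval_homogenize_X_one (p i) (hp i)

lemma compPair_linPair_X_one (g : Matrix (Fin 2) (Fin 2) R) (q : Fin 2 → R[X]) :
    compPair 1 (linPair g ![X, 1]) q = linPair g q := by
  funext i
  simp [compPair, linPair, formEval_one_deg]

lemma linPair_compPair (d : ℕ) (g : Matrix (Fin 2) (Fin 2) R) (p q : Fin 2 → R[X]) :
    compPair d (linPair g p) q = linPair g (compPair d p q) := by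
  funext i
  simp only [compPair, linPair, formEval_add, formEval_C_mul, algebraMap_eq]

lemma linPair_linPair (g h : Matrix (Fin 2) (Fin 2) R) (p : Fin 2 → R[X]) :
    linPair g (linPair h p) = linPair (g * h) p := by
  funext i
  simp only [linPair, Matrix.mul_apply, Fin.sum_univ_two, C_add, C_mul]
  ring

lemma linPair_one (p : Fin 2 → R[X]) : linPair 1 p = p := by
  refine funext (Fin.forall_fin_two.2 ⟨?_, ?_⟩) <;> simp [linPair]

lemma compPair_conjPair {d e : ℕ} (γ : GL (Fin 2) R) (p : Fin 2 → R[X]) {q : Fin 2 → R[X]}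
    (hq : ∀ i, (q i).natDegree ≤ e) :
    compPair d (conjPair d γ p) (conjPair e γ q) = conjPair (d * e) γ (compPair d p q) := by
  have hcancel : compPair 1 (linPair γ.1 ![X, 1]) (conjPair e γ q) =
      compPair e q (linPair γ.1 ![X, 1]) := by
    rw [compPair_linPair_X_one, conjPair, linPair_linPair, γ.mul_inv, linPair_one]
  have hassoc := compPair_assoc (d := d) p (natDegree_linPair_le γ.1 natDegree_X_one_le)
    (conjPair e γ q)
  rw [mul_one, hcancel] at hassoc
  rw [conjPair, linPair_compPair, hassoc, conjPair, compPair_assoc p hq]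

lemma conjPair_X_one (γ : GL (Fin 2) R) : conjPair 1 γ ![X, 1] = ![X, 1] := by
  have hid : compPair 1 ![X, 1] (linPair γ.1 ![X, 1]) = linPair γ.1 ![X, 1] := by
    simpa only [linPair_one] using compPair_linPair_X_one 1 (linPair γ.1 ![X, 1])
  rw [conjPair, hid, linPair_linPair, γ.inv_mul, linPair_one]

lemma iterPair_conjPair (d : ℕ) (γ : GL (Fin 2) R) (p : Fin 2 → R[X]) (n : ℕ) :
    iterPair d (conjPair d γ p) n = conjPair (d ^ n) γ (iterPair d p n) := by
  induction n with
  | zero => exact (conjPair_X_one γ).symm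
  | succ n ih =>
    rw [iterPair, ih, compPair_conjPair γ p (natDegree_iterPair_le d p n), ← pow_succ']
    rfl

variable {T : Type*} [CommRing T] (τ : R →+* T)

lemma map_compPair (d : ℕ) (p q : Fin 2 → R[X]) (i : Fin 2) :
    (compPair d p q i).map τ =
      compPair d (fun i => (p i).map τ) (fun i => (q i).map τ) i :=
  polynomialMap_formEval τ d (p i) q

lemma map_iterPair (d : ℕ) (p : Fin 2 → R[X]) (n : ℕ) (i : Fin 2) :
    (iterPair d p n i).map τ = iterPair d (fun i => (p i).map τ) n i := by
  induction n generalizing i with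
  | zero => fin_cases i <;> simp [iterPair]
  | succ n ih => simp only [iterPair, map_compPair, ih]

lemma map_linPair (g : Matrix (Fin 2) (Fin 2) R) (p : Fin 2 → R[X]) (i : Fin 2) :
    (linPair g p i).map τ = linPair (τ.mapMatrix g) (fun i => (p i).map τ) i := by
  simp [linPair]

lemma map_conjPair (d : ℕ) (γ : GL (Fin 2) R) (p : Fin 2 → R[X]) (i : Fin 2) :
    (conjPair d γ p i).map τ =
      conjPair d (Matrix.GeneralLinearGroup.map τ γ) (fun i => (p i).map τ) i := by
  have hX : (fun i => ((![X, 1] : Fin 2 → R[X]) i).map τ) = ![X, 1] := by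
    funext i
    fin_cases i <;> simp
  have hmap : τ.mapMatrix γ.1 = (Matrix.GeneralLinearGroup.map τ γ).1 := rfl
  have hinv : τ.mapMatrix γ⁻¹.1 = (Matrix.GeneralLinearGroup.map τ γ)⁻¹.1 := by
    rw [← map_inv]
    rfl
  simp only [conjPair, map_linPair, map_compPair, hX, hmap, hinv]

end

/-! ### Coefficient vectors -/

section

variable {R : Type*} [CommRing R] {d : ℕ}

/-- The coefficient vector of the pair of binary forms of degree `d` whose dehomogenization is
`p`. Coefficients of `p` in degrees above `d` are dropped. -/
def toCoeffs (d : ℕ) (p : Fin 2 → R[X]) : Coeffs d R :=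
  fun ij => (p ij.1).coeff ij.2

/-- The coefficients of the `n`-th iterate of a pair of forms. -/
def iterCoeffs (a : Coeffs d R) (n : ℕ) : Coeffs (d ^ n) R :=
  toCoeffs (d ^ n) (iterPair d (coordPoly a) n)

/-- The coefficients of `γ⁻¹ ∘ Φ ∘ γ`, extending `conjCoeffs` from `SL₂` to `GL₂`. -/
def glConjCoeffs (γ : GL (Fin 2) R) (a : Coeffs d R) : Coeffs d R :=
  toCoeffs d (conjPair d γ (coordPoly a))

lemma coordPoly_toCoeffs {p : Fin 2 → R[X]} (hp : ∀ i, (p i).natDegree ≤ d) :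
    coordPoly (toCoeffs d p) = p :=
  funext fun i => coordPoly_of_coeff p i (hp i)

lemma toCoeffs_coordPoly (a : Coeffs d R) : toCoeffs d (coordPoly a) = a :=
  funext fun ij => coeff_coordPoly a ij.1 ij.2

lemma coordPoly_injective : Function.Injective (coordPoly : Coeffs d R → Fin 2 → R[X]) :=
  Function.LeftInverse.injective toCoeffs_coordPoly

lemma coordPoly_smul (c : R) (a : Coeffs d R) : coordPoly (c • a) = C c • coordPoly a := by
  funext i
  simp [coordPoly, Finset.mul_sum, mul_assoc]

lemma coordPoly_iterCoeffs (a : Coeffs d R) (n : ℕ) :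
    coordPoly (iterCoeffs a n) = iterPair d (coordPoly a) n :=
  coordPoly_toCoeffs (natDegree_iterPair_le d _ n)

lemma coordPoly_glConjCoeffs (γ : GL (Fin 2) R) (a : Coeffs d R) :
    coordPoly (glConjCoeffs γ a) = conjPair d γ (coordPoly a) :=
  coordPoly_toCoeffs (natDegree_conjPair_le d γ _)

lemma conjCoeffs_eq_glConjCoeffs (g : SL(2, R)) (a : Coeffs d R) :
    conjCoeffs g a = glConjCoeffs (g : GL (Fin 2) R) a := by
  have hinv : (g : GL (Fin 2) R)⁻¹.1 = g⁻¹.1 := rfl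
  funext ij
  simp only [conjCoeffs, glConjCoeffs, toCoeffs, conjPair, compPair, linPair, Fin.sum_univ_two,
    formEval_eq_sum, Finset.sum_range, coeff_coordPoly, algebraMap_eq, Matrix.cons_val_zero,
    Matrix.cons_val_one, mul_one, hinv]
  rfl

lemma iterCoeffs_glConjCoeffs (γ : GL (Fin 2) R) (a : Coeffs d R) (n : ℕ) :
    iterCoeffs (glConjCoeffs γ a) n = glConjCoeffs γ (iterCoeffs a n) :=
  coordPoly_injective <| by
    rw [coordPoly_iterCoeffs, coordPoly_glConjCoeffs, coordPoly_glConjCoeffs,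
      coordPoly_iterCoeffs, iterPair_conjPair]

variable {T : Type*} [CommRing T] (τ : R →+* T)

lemma map_coordPoly (a : Coeffs d R) (i : Fin 2) :
    (coordPoly a i).map τ = coordPoly (fun ij => τ (a ij)) i := by
  simp [coordPoly, Polynomial.map_sum]

lemma map_iterCoeffs (a : Coeffs d R) (n : ℕ) (ij : Fin 2 × Fin (d ^ n + 1)) :
    τ (iterCoeffs a n ij) = iterCoeffs (fun ij => τ (a ij)) n ij := by
  simp only [iterCoeffs, toCoeffs, ← coeff_map, map_iterPair, map_coordPoly]

lemma map_glConjCoeffs (γ : GL (Fin 2) R) (a : Coeffs d R) (ij : Fin 2 × Fin (d + 1)) :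
    τ (glConjCoeffs γ a ij) =
      glConjCoeffs (Matrix.GeneralLinearGroup.map τ γ) (fun ij => τ (a ij)) ij := by
  simp only [glConjCoeffs, toCoeffs, ← coeff_map, map_conjPair, map_coordPoly]

end

/-! ### Pulling back invariants along iteration -/

section

variable {σ R : Type*} [CommRing R]

/-- All coefficients of the polynomial `p` are homogeneous of degree `s` in the variables `σ`. -/
def HasHomogeneousCoeffs (s : ℕ) (p : (MvPolynomial σ R)[X]) : Prop :=
  ∀ i, (p.coeff i).IsHomogeneous s

namespace HasHomogeneousCoeffs

variable {s t : ℕ} {p q : (MvPolynomial σ R)[X]}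

lemma C_mul_X_pow {H : MvPolynomial σ R} (hH : H.IsHomogeneous s) (j : ℕ) :
    HasHomogeneousCoeffs s (C H * X ^ j) := fun i => by
  rw [coeff_C_mul_X_pow]
  split_ifs
  exacts [hH, MvPolynomial.isHomogeneous_zero _ _ _]

lemma one : HasHomogeneousCoeffs 0 (1 : (MvPolynomial σ R)[X]) := by
  simpa using C_mul_X_pow (MvPolynomial.isHomogeneous_one σ R) 0

lemma X : HasHomogeneousCoeffs 0 (Polynomial.X : (MvPolynomial σ R)[X]) := by
  simpa using C_mul_X_pow (MvPolynomial.isHomogeneous_one σ R) 1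

lemma sum {ι : Type*} {I : Finset ι} {p : ι → (MvPolynomial σ R)[X]}
    (hp : ∀ i ∈ I, HasHomogeneousCoeffs s (p i)) : HasHomogeneousCoeffs s (∑ i ∈ I, p i) :=
  fun j => by
    rw [finsetSum_coeff]
    exact MvPolynomial.IsHomogeneous.sum _ _ _ fun i hi => hp i hi j

lemma mul (hp : HasHomogeneousCoeffs s p) (hq : HasHomogeneousCoeffs t q) :
    HasHomogeneousCoeffs (s + t) (p * q) := fun i => by
  rw [coeff_mul]
  exact MvPolynomial.IsHomogeneous.sum _ _ _ fun x _ => (hp x.1).mul (hq x.2)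

lemma pow (hp : HasHomogeneousCoeffs s p) (j : ℕ) : HasHomogeneousCoeffs (j * s) (p ^ j) := by
  induction j with
  | zero => simpa using one
  | succ j ih => simpa only [pow_succ, add_mul, one_mul] using ih.mul hp

lemma formEval {d : ℕ} {x : Fin 2 → (MvPolynomial σ R)[X]} (hp : HasHomogeneousCoeffs s p)
    (hx : ∀ l, HasHomogeneousCoeffs t (x l)) :
    HasHomogeneousCoeffs (s + d * t) (formEval d p x) := by
  rw [formEval_eq_sum]
  refine sum fun j hj => ?_
  have hcoeff : HasHomogeneousCoeffs s (C (p.coeff j)) := by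
    simpa using C_mul_X_pow (hp j) 0
  have hjd : j + (d - j) = d := Nat.add_sub_cancel' (Finset.mem_range_succ_iff.1 hj)
  simpa only [add_assoc, ← add_mul, hjd, algebraMap_eq] using
    (hcoeff.mul ((hx 0).pow j)).mul ((hx 1).pow (d - j))

lemma coordPoly {d : ℕ} {a : Coeffs d (MvPolynomial σ R)} (ha : ∀ ij, (a ij).IsHomogeneous s)
    (i : Fin 2) : HasHomogeneousCoeffs s (coordPoly a i) :=
  sum fun j _ => C_mul_X_pow (ha (i, j)) j

lemma iterPair {d : ℕ} {p : Fin 2 → (MvPolynomial σ R)[X]}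
    (hp : ∀ i, HasHomogeneousCoeffs 1 (p i)) (n : ℕ) (i : Fin 2) :
    HasHomogeneousCoeffs (∑ l ∈ Finset.range n, d ^ l) (iterPair d p n i) := by
  induction n generalizing i with
  | zero =>
    fin_cases i
    exacts [X, one]
  | succ n ih =>
    rw [geom_sum_succ, add_comm]
    exact (hp i).formEval ih

end HasHomogeneousCoeffs

lemma aeval_map_int {R S : Type*} [CommRing R] [CommRing S] (τ : R →+* S) (x : σ → R)
    (H : MvPolynomial σ ℤ) :
    τ (MvPolynomial.aeval x H) = MvPolynomial.aeval (fun i => τ (x i)) H :=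
  MvPolynomial.comp_aeval_apply x τ.toIntAlgHom H

/-- The pullback of a form on pairs of degree `d ^ n` along the `n`-th iteration map. -/
def iterPullback (d n : ℕ) (H : MvPolynomial (Fin 2 × Fin (d ^ n + 1)) ℤ) :
    MvPolynomial (Fin 2 × Fin (d + 1)) ℤ :=
  MvPolynomial.aeval (iterCoeffs (MvPolynomial.X : Coeffs d (MvPolynomial _ ℤ)) n) H

variable {d n : ℕ} {H : MvPolynomial (Fin 2 × Fin (d ^ n + 1)) ℤ}

lemma aeval_iterPullback (H : MvPolynomial (Fin 2 × Fin (d ^ n + 1)) ℤ) (a : Coeffs d R) :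
    MvPolynomial.aeval a (iterPullback d n H) = MvPolynomial.aeval (iterCoeffs a n) H := by
  have hgen (ij) : (MvPolynomial.aeval a : _ →ₐ[ℤ] R) (iterCoeffs MvPolynomial.X n ij) =
      iterCoeffs a n ij := by
    simpa using map_iterCoeffs (MvPolynomial.aeval a : _ →ₐ[ℤ] R).toRingHom MvPolynomial.X n ij
  rw [iterPullback, MvPolynomial.comp_aeval_apply]
  simp only [hgen]

lemma IsSL2Invariant.iterPullback (hH : IsSL2Invariant.{u} H) :
    IsSL2Invariant.{u} (iterPullback d n H) := fun R _ g a => by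
  rw [aeval_iterPullback, aeval_iterPullback, conjCoeffs_eq_glConjCoeffs, iterCoeffs_glConjCoeffs,
    ← conjCoeffs_eq_glConjCoeffs, hH R g]

lemma isHomogeneous_iterPullback {D : ℕ} (hH : H.IsHomogeneous D) :
    (iterPullback d n H).IsHomogeneous ((∑ l ∈ Finset.range n, d ^ l) * D) :=
  hH.aeval _ fun ij =>
    HasHomogeneousCoeffs.iterPair
      (HasHomogeneousCoeffs.coordPoly fun _ => MvPolynomial.isHomogeneous_X _ _) n ij.1 ij.2

lemma IsSemistable.of_iterCoeffs {k : Type u} [Field k] {a : Coeffs d k} (hd : 0 < d)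
    (hn : 0 < n) (h : IsSemistable (iterCoeffs a n)) : IsSemistable a := by
  obtain ⟨D, H, hD, hH, hinv, hne⟩ := h
  have hpos : 0 < ∑ l ∈ Finset.range n, d ^ l :=
    Finset.sum_pos (fun l _ => pow_pos hd l) (Finset.nonempty_range_iff.2 hn.ne')
  exact ⟨_, iterPullback d n H, Nat.mul_pos hpos hD, isHomogeneous_iterPullback hH,
    hinv.iterPullback, by rwa [aeval_iterPullback]⟩

end

/-! ### The resultant of a composition -/

section

variable {R : Type*} [CommRing R]

lemma resultant_mul_left_of_le {f₁ f₂ g : R[X]} {m₁ m₂ n : ℕ} (h₁ : f₁.natDegree ≤ m₁)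
    (h₂ : f₂.natDegree ≤ m₂) (hg : g.natDegree ≤ n) :
    resultant (f₁ * f₂) g (m₁ + m₂) n = resultant f₁ g m₁ n * resultant f₂ g m₂ n := by
  obtain ⟨a, rfl⟩ := Nat.exists_eq_add_of_le h₁
  obtain ⟨b, rfl⟩ := Nat.exists_eq_add_of_le h₂
  rw [add_add_add_comm, resultant_add_left_deg _ _ _ _ _ natDegree_mul_le,
    resultant_mul_left _ _ _ _ hg, resultant_add_left_deg _ _ _ _ _ le_rfl,
    resultant_add_left_deg _ _ _ _ _ le_rfl]
  ring

lemma resultant_mul_right_of_le {f g₁ g₂ : R[X]} {m n₁ n₂ : ℕ} (h₁ : g₁.natDegree ≤ n₁)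
    (h₂ : g₂.natDegree ≤ n₂) (hf : f.natDegree ≤ m) :
    resultant f (g₁ * g₂) m (n₁ + n₂) = resultant f g₁ m n₁ * resultant f g₂ m n₂ := by
  rw [resultant_comm, resultant_mul_left_of_le h₁ h₂ hf, resultant_comm f g₁,
    resultant_comm f g₂]
  ring

/-- The resultant of a dehomogenized pair of binary forms of degree `d`. -/
def resPair (d : ℕ) (p : Fin 2 → R[X]) : R :=
  resultant (p 0) (p 1) d d

lemma map_resPair {T : Type*} [CommRing T] (τ : R →+* T) (d : ℕ) (p : Fin 2 → R[X]) :
    τ (resPair d p) = resPair d fun i => (p i).map τ :=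
  (resultant_map_map _ _ _ _ τ).symm

lemma resForm_eq_resPair {d : ℕ} (a : Coeffs d R) : resForm a = resPair d (coordPoly a) := rfl

lemma resPair_C_smul (d : ℕ) (c : R) (p : Fin 2 → R[X]) :
    resPair d (C c • p) = c ^ (2 * d) * resPair d p := by
  rw [resPair, Pi.smul_apply, Pi.smul_apply, smul_eq_mul, smul_eq_mul, resultant_C_mul_left,
    resultant_C_mul_right, resPair]
  ring

lemma pow_mul_resPair_linPair {d : ℕ} (g : Matrix (Fin 2) (Fin 2) R) {p : Fin 2 → R[X]}
    (hp : ∀ i, (p i).natDegree ≤ d) :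
    g 0 0 ^ d * resPair d (linPair g p) = g 0 0 ^ d * (g.det ^ d * resPair d p) := by
  have hdet : C (g 0 0) * linPair g p 1 = C g.det * p 1 + linPair g p 0 * C (g 1 0) := by
    simp only [linPair, Matrix.det_fin_two, C_sub, C_mul]
    ring
  calc g 0 0 ^ d * resPair d (linPair g p)
      = resultant (linPair g p 0) (C g.det * p 1 + linPair g p 0 * C (g 1 0)) d d := by
        rw [resPair, ← resultant_C_mul_right, hdet]
    _ = g.det ^ d * resultant (C (g 0 0) * p 0 + p 1 * C (g 0 1)) (p 1) d d := by
        rw [resultant_add_mul_right _ _ _ _ _ (by simp) (natDegree_linPair_le g hp 0),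
          resultant_C_mul_right, linPair, mul_comm (p 1)]
    _ = g 0 0 ^ d * (g.det ^ d * resPair d p) := by
        rw [resultant_add_mul_left _ _ _ _ _ (by simp) (hp 1), resultant_C_mul_left,
          mul_left_comm, resPair]

lemma resPair_linPair {d : ℕ} (g : Matrix (Fin 2) (Fin 2) R) {p : Fin 2 → R[X]}
    (hp : ∀ i, (p i).natDegree ≤ d) : resPair d (linPair g p) = g.det ^ d * resPair d p := by
  -- Replacing `g 0 0` by `g 0 0 + T` makes it cancellable; then specialize to `T = 0`.
  let g' : Matrix (Fin 2) (Fin 2) R[X] := !![X + C (g 0 0), C (g 0 1); C (g 1 0), C (g 1 1)]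
  let p' : Fin 2 → R[X][X] := fun i => (p i).map C
  have hgeneric : resPair d (linPair g' p') = g'.det ^ d * resPair d p' :=
    ((monic_X_add_C (g 0 0)).pow d).isRegular.left <|
      pow_mul_resPair_linPair g' fun i => natDegree_map_le.trans (hp i)
  have hcomp : (evalRingHom (0 : R)).comp C = RingHom.id R := by
    ext
    simp
  have hp' : (fun i => (p' i).map (evalRingHom 0)) = p := by
    simp [p', Polynomial.map_map, hcomp]
  have hg : (fun i => (linPair g' p' i).map (evalRingHom 0)) = linPair g p := by
    funext i
    fin_cases i <;> simp [linPair, g', p', Polynomial.map_map, hcomp]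
  have hdet : evalRingHom 0 g'.det = g.det := by
    simp [g', Matrix.det_fin_two]
  simpa only [map_mul, map_pow, map_resPair, hg, hdet, hp'] using
    congrArg (evalRingHom 0) hgeneric

lemma resPair_linPair_X_one (g : Matrix (Fin 2) (Fin 2) R) :
    resPair 1 (linPair g ![X, 1]) = g.det := by
  rw [resPair_linPair g natDegree_X_one_le]
  simp [resPair]

lemma exists_eq_linPair_X_one {p : Fin 2 → R[X]} (hp : ∀ i, (p i).natDegree ≤ 1) :
    ∃ g, p = linPair g ![X, 1] :=
  ⟨Matrix.of fun i => ![(p i).coeff 1, (p i).coeff 0], funext fun i => by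
    simpa [linPair] using eq_X_add_C_of_natDegree_le_one (hp i)⟩

lemma resPair_compPair_one_deg {e : ℕ} {p q : Fin 2 → R[X]} (hp : ∀ i, (p i).natDegree ≤ 1)
    (hq : ∀ i, (q i).natDegree ≤ e) :
    resPair e (compPair 1 p q) = resPair 1 p ^ e * resPair e q := by
  obtain ⟨g, rfl⟩ := exists_eq_linPair_X_one hp
  rw [compPair_linPair_X_one, resPair_linPair g hq, resPair_linPair_X_one]

end

section

variable {K : Type*} [Field K] [IsAlgClosed K]

lemma exists_linear_factor {d : ℕ} {f : K[X]} (hf : f.natDegree ≤ d + 1) :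
    ∃ l g : K[X], l.natDegree ≤ 1 ∧ g.natDegree ≤ d ∧ f = l * g := by
  by_cases hfd : f.natDegree ≤ d
  · exact ⟨1, f, natDegree_one.trans_le zero_le_one, hfd, (one_mul f).symm⟩
  · have hdeg : f.degree ≠ 0 := fun h =>
      hfd ((natDegree_eq_zero_iff_degree_le_zero.2 h.le).trans_le d.zero_le)
    obtain ⟨x, hx⟩ := IsAlgClosed.exists_root f hdeg
    refine ⟨X - C x, f /ₘ (X - C x), natDegree_X_sub_C_le x, ?_,
      (mul_divByMonic_eq_iff_isRoot.2 hx).symm⟩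
    rw [natDegree_divByMonic f (monic_X_sub_C x), natDegree_X_sub_C]
    exact Nat.sub_le_of_le_add hf

lemma resultant_formEval_of_linear {q : Fin 2 → K[X]} {e n : ℕ} (hq : ∀ i, (q i).natDegree ≤ e)
    {l g : K[X]} (hl : l.natDegree ≤ 1) (hg : g.natDegree ≤ n) :
    resultant (formEval 1 l q) (formEval n g q) e (n * e) =
      resultant l g 1 n ^ e * resPair e q ^ n := by
  induction n generalizing g with
  | zero =>
    obtain ⟨c, rfl⟩ := natDegree_eq_zero.1 (Nat.le_zero.1 hg)
    simp [formEval_zero_deg]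
  | succ n ih =>
    obtain ⟨m, g', hm, hg', rfl⟩ := exists_linear_factor hg
    have hle (f : K[X]) : (formEval 1 f q).natDegree ≤ e :=
      (natDegree_formEval_le f hq).trans_eq (one_mul e)
    have hlm : resultant (formEval 1 l q) (formEval 1 m q) e e =
        resultant l m 1 1 ^ e * resPair e q :=
      resPair_compPair_one_deg (p := ![l, m]) (Fin.forall_fin_two.2 ⟨hl, hm⟩) hq
    rw [add_comm, formEval_mul hm hg', add_mul, one_mul,
      resultant_mul_right_of_le (hle m) (natDegree_formEval_le _ hq) (hle l), ih hg',
      resultant_mul_right_of_le hm hg' hl, hlm]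
    ring

lemma resultant_formEval_of_isAlgClosed {q : Fin 2 → K[X]} {e m n : ℕ}
    (hq : ∀ i, (q i).natDegree ≤ e) {f g : K[X]} (hf : f.natDegree ≤ m) (hg : g.natDegree ≤ n) :
    resultant (formEval m f q) (formEval n g q) (m * e) (n * e) =
      resultant f g m n ^ e * resPair e q ^ (m * n) := by
  induction m generalizing f with
  | zero =>
    obtain ⟨c, rfl⟩ := natDegree_eq_zero.1 (Nat.le_zero.1 hf)
    simp [formEval_zero_deg, pow_mul]
  | succ m ih =>
    obtain ⟨l, f', hl, hf', rfl⟩ := exists_linear_factor hf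
    have hle : (formEval 1 l q).natDegree ≤ e :=
      (natDegree_formEval_le l hq).trans_eq (one_mul e)
    rw [add_comm, formEval_mul hl hf', add_mul, one_mul,
      resultant_mul_left_of_le hle (natDegree_formEval_le _ hq) (natDegree_formEval_le _ hq),
      ih hf', resultant_mul_left_of_le hl hf' hg, resultant_formEval_of_linear hq hl hg]
    ring

end

section

variable {R : Type*} [CommRing R]

lemma resPair_compPair_of_isDomain [IsDomain R] {d e : ℕ} {p q : Fin 2 → R[X]}
    (hp : ∀ i, (p i).natDegree ≤ d) (hq : ∀ i, (q i).natDegree ≤ e) :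
    resPair (d * e) (compPair d p q) = resPair d p ^ e * resPair e q ^ (d * d) := by
  let τ : R →+* AlgebraicClosure (FractionRing R) :=
    (algebraMap (FractionRing R) (AlgebraicClosure (FractionRing R))).comp
      (algebraMap R (FractionRing R))
  have hτ : Function.Injective τ :=
    (algebraMap (FractionRing R) (AlgebraicClosure (FractionRing R))).injective.comp
      (IsFractionRing.injective R (FractionRing R))
  apply hτ
  simp only [map_mul, map_pow, map_resPair, map_compPair]
  exact resultant_formEval_of_isAlgClosed (fun i => natDegree_map_le.trans (hq i))
    (natDegree_map_le.trans (hp 0)) (natDegree_map_le.trans (hp 1))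

lemma resPair_compPair {d e : ℕ} {p q : Fin 2 → R[X]} (hp : ∀ i, (p i).natDegree ≤ d)
    (hq : ∀ i, (q i).natDegree ≤ e) :
    resPair (d * e) (compPair d p q) = resPair d p ^ e * resPair e q ^ (d * d) := by
  -- Both sides are universal polynomials over `ℤ`, so the identity lifts to a domain above `R`.
  let τ : MvPolynomial R ℤ →+* R := MvPolynomial.eval₂Hom (Int.castRingHom R) id
  have hτ : Function.Surjective τ := fun r => ⟨MvPolynomial.X r, by simp [τ]⟩
  have hlift (f : R[X]) : ∃ F : (MvPolynomial R ℤ)[X], F.map τ = f ∧ F.natDegree = f.natDegree :=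
    exists_natDegree_eq_of_mem_lifts (Polynomial.map_surjective τ hτ f)
  choose P hPmap hPdeg using fun i => hlift (p i)
  choose Q hQmap hQdeg using fun i => hlift (q i)
  obtain rfl : (fun i => (P i).map τ) = p := funext hPmap
  obtain rfl : (fun i => (Q i).map τ) = q := funext hQmap
  have hlifted := resPair_compPair_of_isDomain (p := P) (q := Q)
    (fun i => (hPdeg i).trans_le (hp i)) fun i => (hQdeg i).trans_le (hq i)
  simpa only [map_mul, map_pow, map_resPair, map_compPair] using congrArg τ hlifted

variable {d : ℕ}

lemma resForm_smul (c : R) (a : Coeffs d R) : resForm (c • a) = c ^ (2 * d) * resForm a := by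
  rw [resForm_eq_resPair, coordPoly_smul, resPair_C_smul, resForm_eq_resPair]

lemma resForm_iterCoeffs_zero (a : Coeffs d R) : resForm (iterCoeffs a 0) = 1 := by
  rw [resForm_eq_resPair, coordPoly_iterCoeffs]
  simp [resPair, iterPair]

lemma resForm_iterCoeffs_succ (a : Coeffs d R) (n : ℕ) :
    resForm (iterCoeffs a (n + 1)) =
      resForm a ^ d ^ n * resForm (iterCoeffs a n) ^ (d * d) := by
  simp only [resForm_eq_resPair, coordPoly_iterCoeffs, pow_succ' d n]
  exact resPair_compPair (natDegree_coordPoly_le a) (natDegree_iterPair_le d _ n)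

lemma resForm_glConjCoeffs (γ : GL (Fin 2) R) (a : Coeffs d R) :
    γ.1.det ^ d * resForm (glConjCoeffs γ a) = γ.1.det ^ (d * d) * resForm a := by
  have hright : resPair d (compPair d (coordPoly a) (linPair γ.1 ![X, 1])) =
      resForm a * γ.1.det ^ (d * d) := by
    simpa only [mul_one, pow_one, resPair_linPair_X_one, resForm_eq_resPair] using
      resPair_compPair (natDegree_coordPoly_le a) (natDegree_linPair_le γ.1 natDegree_X_one_le)
  have hdet : γ.1.det * γ⁻¹.1.det = 1 := by
    rw [← Matrix.det_mul, γ.mul_inv, Matrix.det_one]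
  rw [resForm_eq_resPair, coordPoly_glConjCoeffs, conjPair,
    resPair_linPair _ (natDegree_compPair_linPair_X_one_le d γ.1 _), hright, ← mul_assoc,
    ← mul_pow, hdet, one_pow, one_mul, mul_comm]

end

/-! ### Vanishing of iterates -/

section

lemma formEval_eq_pow_mul_aeval_div {R L : Type*} [CommRing R] [Field L] [Algebra R L] {d : ℕ}
    {f : R[X]} (hf : f.natDegree ≤ d) {x : Fin 2 → L} (hx : x 1 ≠ 0) :
    formEval d f x = x 1 ^ d * aeval (x 0 / x 1) f := by
  have hsmul : x = x 1 • ![x 0 / x 1, 1] :=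
    funext (Fin.forall_fin_two.2 ⟨(mul_div_cancel₀ _ hx).symm, (mul_one _).symm⟩)
  conv_lhs => rw [hsmul, formEval_smul]
  rw [formEval, aeval_homogenize_of_eq_one hf _ rfl]
  rfl

variable {k : Type*} [Field k]

lemma algebraMap_formEval {d : ℕ} {f : k[X]} (hf : f.natDegree ≤ d) {q : Fin 2 → k[X]}
    (hq : q 1 ≠ 0) :
    algebraMap k[X] (RatFunc k) (formEval d f q) =
      algebraMap k[X] (RatFunc k) (q 1) ^ d *
        aeval (algebraMap k[X] (RatFunc k) (q 0) / algebraMap k[X] (RatFunc k) (q 1)) f :=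
  (map_formEval (IsScalarTower.toAlgHom k k[X] (RatFunc k)) d f q).trans <|
    formEval_eq_pow_mul_aeval_div hf <| by simpa using hq

lemma formEval_ne_zero {d : ℕ} {f : k[X]} (hf : f.natDegree ≤ d) (hf0 : f ≠ 0)
    {q : Fin 2 → k[X]} (hq : LinearIndependent k q) : formEval d f q ≠ 0 := by
  obtain ⟨hq1, hq0⟩ := linearIndependent_fin2.1 hq
  have hq1' : algebraMap k[X] (RatFunc k) (q 1) ≠ 0 := by simpa using hq1
  have htrans : Transcendental k
      (algebraMap k[X] (RatFunc k) (q 0) / algebraMap k[X] (RatFunc k) (q 1)) := by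
    refine RatFunc.transcendental_of_ne_C _ fun ⟨c, hc⟩ => ?_
    refine hq0 c (RatFunc.algebraMap_injective k ?_)
    rw [smul_eq_C_mul, map_mul, RatFunc.algebraMap_C, ← hc, div_mul_cancel₀ _ hq1']
  intro h
  have hval := algebraMap_formEval hf hq1
  rw [h, map_zero, zero_eq_mul, or_iff_right (pow_ne_zero d hq1')] at hval
  exact hf0 (transcendental_iff.1 htrans f hval)

lemma linearIndependent_X_one : LinearIndependent k ![(X : k[X]), 1] :=
  linearIndependent_fin2.2 ⟨one_ne_zero, fun a h => by
    simpa [coeff_one, coeff_X] using congrArg (fun f : k[X] => f.coeff 1) h⟩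

lemma linearIndependent_compPair {d : ℕ} {p q : Fin 2 → k[X]}
    (hd : ∀ i, (p i).natDegree ≤ d) (hp : LinearIndependent k p) (hq : LinearIndependent k q) :
    LinearIndependent k (compPair d p q) := by
  obtain ⟨hp1, hp0⟩ := linearIndependent_fin2.1 hp
  refine linearIndependent_fin2.2 ⟨formEval_ne_zero (hd 1) hp1 hq, fun c h => ?_⟩
  have hne : C (-c) * p 1 + p 0 ≠ 0 := fun h0 => hp0 c <| by
    rw [C_neg, neg_mul, neg_add_eq_zero] at h0
    rw [smul_eq_C_mul, h0]
  have hdeg : (C (-c) * p 1 + p 0).natDegree ≤ d :=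
    natDegree_add_le_of_degree_le ((natDegree_C_mul_le _ _).trans (hd 1)) (hd 0)
  refine formEval_ne_zero hdeg hne hq ?_
  rw [formEval_add, formEval_C_mul, algebraMap_eq, C_neg, neg_mul, neg_add_eq_zero,
    ← smul_eq_C_mul]
  exact h

lemma exists_eq_C_mul_of_not_linearIndependent {p : Fin 2 → k[X]}
    (h : ¬ LinearIndependent k p) :
    ∃ (w : Fin 2 → k) (A : k[X]), p = fun i => C (w i) * A := by
  rw [linearIndependent_fin2, not_and_or, not_not] at h
  obtain hp1 | h := h
  · exact ⟨![1, 0], p 0, funext (Fin.forall_fin_two.2 ⟨by simp, by simp [hp1]⟩)⟩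
  · push Not at h
    obtain ⟨c, hc⟩ := h
    exact ⟨![c, 1], p 1,
      funext (Fin.forall_fin_two.2 ⟨by simp [← hc, smul_eq_C_mul], by simp⟩)⟩

lemma compPair_C_mul {R : Type*} [CommRing R] (d : ℕ) (w : Fin 2 → R) (A B : R[X]) :
    compPair d (fun i => C (w i) * A) (fun i => C (w i) * B) =
      fun i => C (w i) * (B ^ d * C (formEval d A w)) := by
  have hsmul : (fun i => C (w i) * B) = B • fun i => C (w i) :=
    funext fun i => mul_comm _ _
  funext i
  rw [compPair, formEval_C_mul, hsmul, formEval_smul]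
  congr 2
  exact (map_formEval (CAlgHom : R →ₐ[R] R[X]) d A w).symm

lemma exists_iterPair_C_mul_eq {d : ℕ} {w : Fin 2 → k} {A : k[X]}
    (hA : ∀ i, (C (w i) * A).natDegree ≤ d) (m : ℕ) :
    ∃ B : k[X], iterPair d (fun i => C (w i) * A) (m + 1) = (fun i => C (w i) * B) ∧
      (formEval d A w ≠ 0 → B ≠ 0) := by
  induction m with
  | zero =>
    refine ⟨A, compPair_X_one hA, ?_⟩
    rintro hw rfl
    simp [formEval] at hw
  | succ m ih =>
    obtain ⟨B, hB, hB0⟩ := ih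
    exact ⟨_, by rw [iterPair, hB, compPair_C_mul],
      fun hw => mul_ne_zero (pow_ne_zero d (hB0 hw)) (C_ne_zero.2 hw)⟩

lemma iterPair_ne_zero {d : ℕ} {p : Fin 2 → k[X]} (hp : ∀ i, (p i).natDegree ≤ d) {n : ℕ}
    (hn : 2 ≤ n) (h : iterPair d p n ≠ 0) (m : ℕ) : iterPair d p m ≠ 0 := by
  by_cases hind : LinearIndependent k p
  · suffices hm : LinearIndependent k (iterPair d p m) from
      fun h0 => hm.ne_zero 0 (congrFun h0 0)
    induction m with
    | zero => exact linearIndependent_X_one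
    | succ m ih => exact linearIndependent_compPair hp hind ih
  · obtain ⟨w, A, rfl⟩ := exists_eq_C_mul_of_not_linearIndependent hind
    have hiter := exists_iterPair_C_mul_eq hp
    obtain ⟨l, rfl⟩ := Nat.exists_eq_add_of_le' hn
    obtain ⟨B, hB, -⟩ := hiter l
    rw [iterPair, hB, compPair_C_mul] at h
    obtain ⟨i, hi⟩ := Function.ne_iff.1 h
    have hwi : w i ≠ 0 := C_ne_zero.1 (left_ne_zero_of_mul hi)
    have hAw : formEval d A w ≠ 0 := C_ne_zero.1 (right_ne_zero_of_mul (right_ne_zero_of_mul hi))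
    cases m with
    | zero => exact fun h0 => one_ne_zero (congrFun h0 1)
    | succ m =>
      obtain ⟨B, hB, hB0⟩ := hiter m
      rw [hB]
      exact fun h0 => mul_ne_zero (C_ne_zero.2 hwi) (hB0 hAw) (congrFun h0 i)

end

/-! ### Lifts of compositions, iterates and conjugates -/

section

variable {K : Type*} [Field K] {d e : ℕ} {φ ψ : RatFunc K}

lemma IsLift.ne_zero {a : Coeffs d K} (h : IsLift φ a) : a ≠ 0 := by
  rintro rfl
  exact h.2.1 (by simp [coordPoly])

lemma IsLift.smul {a : Coeffs d K} (h : IsLift φ a) {c : K} (hc : c ≠ 0) :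
    IsLift φ (c • a) := by
  refine ⟨?_, ?_, ?_⟩
  · rw [resForm_smul]
    exact mul_ne_zero (pow_ne_zero _ hc) h.1
  · rw [coordPoly_smul]
    exact mul_ne_zero (C_ne_zero.2 hc) h.2.1
  · rw [coordPoly_smul, Pi.smul_apply, Pi.smul_apply, smul_eq_mul, smul_eq_mul, map_mul, map_mul,
      mul_div_mul_left _ _ (by simpa using hc)]
    exact h.2.2

lemma IsLift.exists_eq_smul {a b : Coeffs d K} (ha : IsLift φ a) (hb : IsLift φ b) :
    ∃ t : K, b = t • a := by
  obtain ⟨-, c, hc, ha0, ha1⟩ := ha.eq_smul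
  obtain ⟨-, c', -, hb0, hb1⟩ := hb.eq_smul
  have hcc : C (c' / c) * C c = C c' := by rw [← C_mul, div_mul_cancel₀ _ hc]
  refine ⟨c' / c, coordPoly_injective ?_⟩
  rw [coordPoly_smul]
  refine funext (Fin.forall_fin_two.2 ⟨?_, ?_⟩)
  · rw [Pi.smul_apply, smul_eq_mul, ha0, hb0, ← mul_assoc, hcc]
  · rw [Pi.smul_apply, smul_eq_mul, ha1, hb1, ← mul_assoc, hcc]

lemma isLift_toCoeffs (hd : 0 < d) {p : Fin 2 → K[X]} (hp : ∀ i, (p i).natDegree ≤ d)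
    (hres : resPair d p ≠ 0)
    (hφ : φ = algebraMap K[X] (RatFunc K) (p 0) / algebraMap K[X] (RatFunc K) (p 1)) :
    IsLift φ (toCoeffs d p) := by
  rw [IsLift, resForm_eq_resPair, coordPoly_toCoeffs hp]
  refine ⟨hres, fun h0 => hres ?_, hφ⟩
  rw [resPair, h0, resultant_zero_right, zero_pow hd.ne', zero_mul]

lemma IsLift.comp_eq_aeval_div {a : Coeffs d K} (h : IsLift φ a) (ψ : RatFunc K) :
    comp φ ψ = aeval ψ (coordPoly a 0) / aeval ψ (coordPoly a 1) := by
  obtain ⟨-, c, hc, h0, h1⟩ := h.eq_smul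
  have hc' : algebraMap K (RatFunc K) c ≠ 0 := by simpa using hc
  rw [h0, h1, map_mul, map_mul, aeval_C, mul_div_mul_left _ _ hc']
  rfl

lemma IsLift.comp (hd : 0 < d) (he : 0 < e) {a : Coeffs d K} {b : Coeffs e K}
    (ha : IsLift φ a) (hb : IsLift ψ b) :
    IsLift (comp φ ψ) (toCoeffs (d * e) (compPair d (coordPoly a) (coordPoly b))) := by
  have hb1 : algebraMap K[X] (RatFunc K) (coordPoly b 1) ^ d ≠ 0 :=
    pow_ne_zero d (by simpa using hb.2.1)
  refine isLift_toCoeffs (Nat.mul_pos hd he)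
    (fun i => natDegree_formEval_le _ (natDegree_coordPoly_le b)) ?_ ?_
  · rw [resPair_compPair (natDegree_coordPoly_le a) (natDegree_coordPoly_le b)]
    exact mul_ne_zero (pow_ne_zero _ ha.1) (pow_ne_zero _ hb.1)
  · rw [compPair, compPair, algebraMap_formEval (natDegree_coordPoly_le a 0) hb.2.1,
      algebraMap_formEval (natDegree_coordPoly_le a 1) hb.2.1, ← hb.2.2,
      mul_div_mul_left _ _ hb1, ha.comp_eq_aeval_div]

lemma isLift_iter (hd : 0 < d) {a : Coeffs d K} (h : IsLift φ a) (n : ℕ) :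
    IsLift (iter φ n) (iterCoeffs a n) := by
  induction n with
  | zero =>
    refine isLift_toCoeffs one_pos natDegree_X_one_le ?_ ?_ <;> simp [resPair, iter, iterPair]
  | succ n ih =>
    rw [iterCoeffs, pow_succ', iterPair, ← coordPoly_iterCoeffs]
    exact h.comp hd (pow_pos hd n) ih

lemma isLift_mobius (γ : GL (Fin 2) K) :
    IsLift (mobius γ) (toCoeffs 1 (linPair γ.1 ![X, 1])) := by
  refine isLift_toCoeffs one_pos (natDegree_linPair_le γ.1 natDegree_X_one_le) ?_ ?_
  · rw [resPair_linPair_X_one]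
    exact γ.det.ne_zero
  · simp [mobius, linPair]

lemma isLift_conj (hd : 0 < d) {a : Coeffs d K} (h : IsLift φ a) (γ : GL (Fin 2) K) :
    IsLift (conj φ γ) (glConjCoeffs γ a) := by
  have hlin (γ : GL (Fin 2) K) := coordPoly_toCoeffs (natDegree_linPair_le γ.1 natDegree_X_one_le)
  have hright := h.comp hd one_pos (isLift_mobius γ)
  rw [mul_one, hlin] at hright
  have hconj := (isLift_mobius γ⁻¹).comp one_pos hd hright
  rwa [one_mul, hlin, coordPoly_toCoeffs (natDegree_compPair_linPair_X_one_le d γ.1 _),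
    compPair_linPair_X_one] at hconj

lemma conj_one (φ : RatFunc K) : conj φ 1 = φ := by
  have hmobius : mobius (1 : GL (Fin 2) K) = RatFunc.X := by simp [mobius]
  have hright : comp φ RatFunc.X = φ := by
    have hX (p : K[X]) : p.eval₂ RatFunc.C RatFunc.X = algebraMap K[X] (RatFunc K) p := by
      rw [← RatFunc.algebraMap_X, ← RatFunc.algebraMap_comp_C, ← hom_eval₂, eval₂_C_X]
    rw [comp, RatFunc.eval, hX, hX, φ.num_div_denom]
  rw [conj, inv_one, hmobius, hright, comp, RatFunc.eval_X]

end

/-! ### Invariants and conjugation by `GL₂` -/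

section

variable {R : Type*} [CommRing R] {c : R} {γ δ : GL (Fin 2) R} {d : ℕ}

lemma smul_conjPair_of_eq_smul (h : γ.1 = c • δ.1) (d : ℕ) (p : Fin 2 → R[X]) :
    C c • conjPair d γ p = C (c ^ d) • conjPair d δ p := by
  have hX : linPair γ.1 ![X, 1] = C c • linPair δ.1 ![X, 1] := by
    funext i
    simp [h, linPair, mul_add, mul_assoc]
  have hinv : c • γ⁻¹.1 = δ⁻¹.1 := by
    calc c • γ⁻¹.1 = δ⁻¹.1 * (c • δ.1) * γ⁻¹.1 := by
          rw [mul_smul_comm, δ.inv_mul, smul_mul_assoc, one_mul]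
      _ = δ⁻¹.1 := by rw [← h, mul_assoc, γ.mul_inv, mul_one]
  funext i
  simp only [conjPair, ← hinv, hX, linPair, compPair, formEval_smul, Pi.smul_apply,
    Matrix.smul_apply, smul_eq_mul, C_mul, C_pow]
  ring

lemma smul_glConjCoeffs_of_eq_smul (h : γ.1 = c • δ.1) (a : Coeffs d R) :
    c • glConjCoeffs γ a = c ^ d • glConjCoeffs δ a :=
  coordPoly_injective <| by
    simp only [coordPoly_smul, coordPoly_glConjCoeffs, smul_conjPair_of_eq_smul h]

lemma exists_eq_smul_specialLinear {L : Type*} [Field L] [IsAlgClosed L] (γ : GL (Fin 2) L) :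
    ∃ (c : L) (g : SL(2, L)), c ^ 2 = γ.1.det ∧ γ.1 = c • (g : GL (Fin 2) L).1 := by
  obtain ⟨c, hc⟩ := IsAlgClosed.exists_pow_nat_eq γ.1.det two_pos
  have hc0 : c ≠ 0 := by
    rintro rfl
    exact γ.det.ne_zero (by simpa using hc.symm)
  refine ⟨c, ⟨c⁻¹ • γ.1, ?_⟩, hc, (smul_inv_smul₀ hc0 _).symm⟩
  rw [Matrix.det_smul, Fintype.card_fin, ← hc, ← mul_pow, inv_mul_cancel₀ hc0, one_pow]

variable {E : ℕ} {H : MvPolynomial (Fin 2 × Fin (d + 1)) ℤ}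

/-- The identity `H (γ⁻¹ ∘ a ∘ γ) = (det γ) ^ (E * (d - 1) / 2) * H a`, squared and cleared of
denominators because the exponent may be a half-integer. -/
lemma IsSL2Invariant.det_pow_mul_aeval_glConjCoeffs_sq_of_isAlgClosed {L : Type u} [Field L]
    [IsAlgClosed L] (hinv : IsSL2Invariant.{u} H) (hH : H.IsHomogeneous E) (γ : GL (Fin 2) L)
    (a : Coeffs d L) :
    γ.1.det ^ E * MvPolynomial.aeval (glConjCoeffs γ a) H ^ 2 =
      γ.1.det ^ (d * E) * MvPolynomial.aeval a H ^ 2 := by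
  obtain ⟨c, g, hc, hg⟩ := exists_eq_smul_specialLinear γ
  have hvalue : c ^ E * MvPolynomial.aeval (glConjCoeffs γ a) H =
      (c ^ d) ^ E * MvPolynomial.aeval a H := by
    rw [← aeval_smul_of_isHomogeneous hH, smul_glConjCoeffs_of_eq_smul hg,
      aeval_smul_of_isHomogeneous hH, ← conjCoeffs_eq_glConjCoeffs, hinv]
  calc _ = (c ^ E * MvPolynomial.aeval (glConjCoeffs γ a) H) ^ 2 := by rw [← hc]; ring
    _ = _ := by rw [hvalue, ← hc]; ring

lemma IsSL2Invariant.det_pow_mul_aeval_glConjCoeffs_sq {K : Type u} [Field K]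
    (hinv : IsSL2Invariant.{u} H) (hH : H.IsHomogeneous E) (γ : GL (Fin 2) K) (a : Coeffs d K) :
    γ.1.det ^ E * MvPolynomial.aeval (glConjCoeffs γ a) H ^ 2 =
      γ.1.det ^ (d * E) * MvPolynomial.aeval a H ^ 2 := by
  let τ : K →+* AlgebraicClosure K := algebraMap K (AlgebraicClosure K)
  have hdet : τ γ.1.det = (Matrix.GeneralLinearGroup.map τ γ).1.det := RingHom.map_det τ γ.1
  apply τ.injective
  simp only [map_mul, map_pow, hdet, aeval_map_int, map_glConjCoeffs]
  exact hinv.det_pow_mul_aeval_glConjCoeffs_sq_of_isAlgClosed hH _ _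

end

/-! ### Normalized lifts and minimality -/

section

variable {K : Type u} [NormedField K]

lemma exists_ne_zero_and_forall_norm_le {ι E : Type*} [Finite ι] [NormedAddCommGroup E]
    {a : ι → E} (ha : a ≠ 0) : ∃ m, a m ≠ 0 ∧ ∀ i, ‖a i‖ ≤ ‖a m‖ := by
  obtain ⟨i, hi⟩ := Function.ne_iff.1 ha
  have : Nonempty ι := ⟨i⟩
  obtain ⟨m, hm⟩ := Finite.exists_max fun i => ‖a i‖
  exact ⟨m, norm_pos_iff.1 ((norm_pos_iff.2 hi).trans_le (hm i)), hm⟩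

variable [IsUltrametricDist K]

lemma mem_integers_iff {x : K} : x ∈ Integers K ↔ ‖x‖ ≤ 1 :=
  Iff.rfl

lemma residue_ne_zero_iff (x : Integers K) :
    IsLocalRing.residue (Integers K) x ≠ 0 ↔ ‖(x : K)‖ = 1 := by
  rw [IsLocalRing.residue_ne_zero_iff_isUnit,
    (Valuation.valuationSubring.integers NormedField.valuation).isUnit_iff_valuation_eq_one]
  exact NNReal.coe_eq_one.symm

lemma one_lt_logBase : 1 < logBase K := by
  unfold logBase
  split_ifs with h
  · exact Real.one_lt_exp_iff.2 one_pos
  · have hprime := (CharP.char_is_prime_or_zero (Residue K) (ringChar (Residue K))).resolve_right h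
    exact_mod_cast hprime.one_lt

lemma ord_one : ord (1 : K) = 0 := by simp [ord]

lemma ord_mul {x y : K} (hx : x ≠ 0) (hy : y ≠ 0) : ord (x * y) = ord x + ord y := by
  rw [ord, norm_mul, Real.logb_mul (norm_ne_zero_iff.2 hx) (norm_ne_zero_iff.2 hy), neg_add]
  rfl

lemma ord_pow (x : K) (n : ℕ) : ord (x ^ n) = n * ord x := by
  rw [ord, norm_pow, Real.logb_pow, ord, mul_neg]

lemma ord_inv (x : K) : ord x⁻¹ = -ord x := by
  rw [ord, norm_inv, Real.logb_inv, ord]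

lemma ord_eq_zero_iff {x : K} (hx : x ≠ 0) : ord x = 0 ↔ ‖x‖ = 1 := by
  rw [ord, neg_eq_zero, ← Real.logb_one (b := logBase K)]
  exact (Real.logb_injOn_pos one_lt_logBase).eq_iff (norm_pos_iff.2 hx)
    (Set.mem_Ioi.2 one_pos)

lemma ord_le_ord {x y : K} (hx : x ≠ 0) (h : ‖x‖ ≤ ‖y‖) : ord y ≤ ord x :=
  neg_le_neg (Real.logb_le_logb_of_le one_lt_logBase (norm_pos_iff.2 hx) h)

lemma inv_smul_mem_integers {ι : Type*} {a : ι → K} {c : K} (hc : c ≠ 0)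
    (ha : ∀ i, ‖a i‖ ≤ ‖c‖) (i : ι) : (c⁻¹ • a) i ∈ Integers K := by
  rw [mem_integers_iff, Pi.smul_apply, smul_eq_mul, norm_mul, norm_inv,
    inv_mul_le_one₀ (norm_pos_iff.2 hc)]
  exact ha i

lemma coe_aeval_int {σ : Type*} (a : σ → Integers K) (H : MvPolynomial σ ℤ) :
    (MvPolynomial.aeval a H : K) = MvPolynomial.aeval (fun i => (a i : K)) H :=
  aeval_map_int (Integers K).subtype a H

lemma norm_aeval_le {σ : Type*} {D : ℕ} {H : MvPolynomial σ ℤ} (hH : H.IsHomogeneous D)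
    {a : σ → K} {c : K} (hc : c ≠ 0) (ha : ∀ i, ‖a i‖ ≤ ‖c‖) :
    ‖MvPolynomial.aeval a H‖ ≤ ‖c‖ ^ D := by
  have hle : ‖MvPolynomial.aeval (c⁻¹ • a) H‖ ≤ 1 := by
    have hcoe := coe_aeval_int (fun i => ⟨_, inv_smul_mem_integers hc ha i⟩) H
    rw [← mem_integers_iff]
    exact hcoe ▸ Subtype.property _
  calc ‖MvPolynomial.aeval a H‖ = ‖c‖ ^ D * ‖MvPolynomial.aeval (c⁻¹ • a) H‖ := by
        rw [← norm_pow, ← norm_mul, ← aeval_smul_of_isHomogeneous hH, smul_inv_smul₀ hc]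
    _ ≤ ‖c‖ ^ D := mul_le_of_le_one_right (by positivity) hle

variable {d : ℕ} {φ : RatFunc K}

lemma norm_aeval_eq_one_of_aeval_reduce_ne_zero {a : Coeffs d (Integers K)}
    {H : MvPolynomial (Fin 2 × Fin (d + 1)) ℤ} (h : MvPolynomial.aeval (reduce a) H ≠ 0) :
    ‖MvPolynomial.aeval (fun ij => (a ij : K)) H‖ = 1 := by
  rw [← coe_aeval_int, ← residue_ne_zero_iff, aeval_map_int]
  exact h

lemma isNormalizedLift_iff_reduce_ne_zero {a : Coeffs d (Integers K)} :
    IsNormalizedLift φ a ↔ IsLift φ (fun ij => (a ij : K)) ∧ reduce a ≠ 0 := by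
  simp only [IsNormalizedLift, Function.ne_iff, reduce, Pi.zero_apply, residue_ne_zero_iff]

lemma ordRes_eq_sub {a : Coeffs d K} (h : IsLift φ a) {m : Fin 2 × Fin (d + 1)}
    (hm0 : a m ≠ 0) (hm : ∀ ij, ‖a ij‖ ≤ ‖a m‖) :
    ordRes φ = ord (resForm a) - 2 * d * ord (a m) := by
  have hnorm : IsNormalizedLift φ
      (fun ij => (⟨_, inv_smul_mem_integers hm0 hm ij⟩ : Integers K)) :=
    ⟨h.smul (inv_ne_zero hm0), m, by simp [hm0]⟩
  rw [ordRes_eq hnorm, resForm_smul, ord_mul (pow_ne_zero _ (inv_ne_zero hm0)) h.1, ord_pow,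
    ord_inv]
  push_cast
  ring

lemma IsNormalizedLift.isSemistable_reduce {a : Coeffs d (Integers K)}
    (ha : IsNormalizedLift φ a) (h : HasSemistableReduction φ) : IsSemistable (reduce a) := by
  obtain ⟨d', b, hb, D, H, hD, hH, hinv, hne⟩ := h
  obtain rfl : d = d' := ha.1.eq_smul.1.trans hb.1.eq_smul.1.symm
  obtain ⟨t, hbt⟩ := ha.1.exists_eq_smul hb.1
  have ht : t ∈ Integers K := by
    obtain ⟨s, hs⟩ := ha.2
    have hbs := mem_integers_iff.1 (b s).2
    rwa [congrFun hbt s, Pi.smul_apply, smul_eq_mul, norm_mul, hs, mul_one,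
      ← mem_integers_iff] at hbs
  have hba : b = (⟨t, ht⟩ : Integers K) • a := funext fun ij => Subtype.ext (congrFun hbt ij)
  have hred : reduce b = IsLocalRing.residue (Integers K) ⟨t, ht⟩ • reduce a := by
    funext ij
    simp [hba, reduce]
  rw [hred, aeval_smul_of_isHomogeneous hH] at hne
  exact ⟨D, H, hD, hH, hinv, right_ne_zero_of_mul hne⟩

lemma two_mul_ord_le_of_isSemistable {a : Coeffs d (Integers K)} (hs : IsSemistable (reduce a))
    {γ : GL (Fin 2) K} {m : Fin 2 × Fin (d + 1)}
    (hm0 : glConjCoeffs γ (fun ij => (a ij : K)) m ≠ 0)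
    (hm : ∀ ij, ‖glConjCoeffs γ (fun ij => (a ij : K)) ij‖ ≤
      ‖glConjCoeffs γ (fun ij => (a ij : K)) m‖) :
    2 * ord (glConjCoeffs γ (fun ij => (a ij : K)) m) ≤ (d - 1) * ord γ.1.det := by
  obtain ⟨E, H, hE, hH, hinv, hne⟩ := hs
  have hdet : γ.1.det ≠ 0 := γ.det.ne_zero
  have hid := congrArg norm (hinv.det_pow_mul_aeval_glConjCoeffs_sq hH γ fun ij => (a ij : K))
  rw [norm_mul, norm_mul, norm_pow _ 2, norm_pow _ 2,
    norm_aeval_eq_one_of_aeval_reduce_ne_zero hne, one_pow, mul_one] at hid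
  set c := glConjCoeffs γ (fun ij => (a ij : K)) m
  have hpow : ‖γ.1.det ^ d‖ ^ E ≤ ‖γ.1.det * c ^ 2‖ ^ E := by
    calc ‖γ.1.det ^ d‖ ^ E = ‖γ.1.det ^ E‖ * _ ^ 2 := by
          rw [← norm_pow, ← pow_mul, ← hid]
      _ ≤ ‖γ.1.det ^ E‖ * (‖c‖ ^ E) ^ 2 := by
          gcongr
          exact norm_aeval_le hH hm0 hm
      _ = ‖γ.1.det * c ^ 2‖ ^ E := by
          simp only [norm_mul, norm_pow]
          ring
  have hle := ord_le_ord (pow_ne_zero d hdet) (le_of_pow_le_pow_left₀ hE.ne' (norm_nonneg _) hpow)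
  rw [ord_mul hdet (pow_ne_zero 2 hm0), ord_pow, ord_pow] at hle
  push_cast at hle
  linarith

lemma ordRes_le_ordRes_conj (hd : 0 < d) {a : Coeffs d (Integers K)} (ha : IsNormalizedLift φ a)
    (hs : IsSemistable (reduce a)) (γ : GL (Fin 2) K) : ordRes φ ≤ ordRes (conj φ γ) := by
  have hdet : γ.1.det ≠ 0 := γ.det.ne_zero
  have hlift := isLift_conj hd ha.1 γ
  obtain ⟨m, hm0, hm⟩ := exists_ne_zero_and_forall_norm_le hlift.ne_zero
  have hres := congrArg ord (resForm_glConjCoeffs γ fun ij => (a ij : K))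
  rw [ord_mul (pow_ne_zero _ hdet) hlift.1, ord_mul (pow_ne_zero _ hdet) ha.1.1, ord_pow,
    ord_pow, ← ordRes_eq ha] at hres
  rw [ordRes_eq_sub hlift hm0 hm]
  have hbound := mul_le_mul_of_nonneg_left (two_mul_ord_le_of_isSemistable hs hm0 hm)
    (Nat.cast_nonneg (α := ℝ) d)
  push_cast at hres
  linarith

lemma isMinimalResultant_of_isSemistable (hd : 0 < d) {a : Coeffs d (Integers K)}
    (ha : IsNormalizedLift φ a) (hs : IsSemistable (reduce a)) :
    IsMinimalResultant φ (ordRes φ) :=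
  ⟨⟨1, by simp only [conj_one]⟩, Set.forall_mem_range.2 (ordRes_le_ordRes_conj hd ha hs)⟩

end

/-! ### The resultant iteration formula -/

section

lemma iterExponent_succ {d : ℕ} (hd : 2 ≤ d) (n : ℕ) :
    iterExponent d (n + 1) = (d : ℝ) ^ n + d * d * iterExponent d n := by
  have h0 : (d : ℝ) ≠ 0 := by positivity
  have h1 : (d : ℝ) - 1 ≠ 0 := sub_ne_zero.2 (by exact_mod_cast (show d ≠ 1 by omega))
  unfold iterExponent
  field_simp
  ring

lemma resForm_iterCoeffs_ne_zero {K : Type*} [Field K] {d : ℕ} {a : Coeffs d K}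
    (ha : resForm a ≠ 0) (n : ℕ) : resForm (iterCoeffs a n) ≠ 0 := by
  induction n with
  | zero => exact (resForm_iterCoeffs_zero a).trans_ne one_ne_zero
  | succ n ih =>
    rw [resForm_iterCoeffs_succ]
    exact mul_ne_zero (pow_ne_zero _ ha) (pow_ne_zero _ ih)

variable {K : Type u} [NormedField K] [IsUltrametricDist K] {d : ℕ} {φ : RatFunc K}

lemma coe_iterCoeffs (a : Coeffs d (Integers K)) (n : ℕ) :
    (fun ij => (iterCoeffs a n ij : K)) = iterCoeffs (fun ij => (a ij : K)) n :=
  funext (map_iterCoeffs (Integers K).subtype a n)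

lemma reduce_iterCoeffs (a : Coeffs d (Integers K)) (n : ℕ) :
    reduce (iterCoeffs a n) = iterCoeffs (reduce a) n :=
  funext (map_iterCoeffs (IsLocalRing.residue (Integers K)) a n)

lemma ord_resForm_iterCoeffs (hd : 2 ≤ d) {a : Coeffs d K} (ha : resForm a ≠ 0) (n : ℕ) :
    ord (resForm (iterCoeffs a n)) = iterExponent d n * ord (resForm a) := by
  induction n with
  | zero =>
    rw [resForm_iterCoeffs_zero, ord_one]
    simp [iterExponent]
  | succ n ih =>
    rw [resForm_iterCoeffs_succ, ord_mul (pow_ne_zero _ ha)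
      (pow_ne_zero _ (resForm_iterCoeffs_ne_zero ha n)), ord_pow, ord_pow, ih,
      iterExponent_succ hd]
    push_cast
    ring

lemma ordRes_iter_eq_iff (hd : 2 ≤ d) {a : Coeffs d (Integers K)} (ha : IsNormalizedLift φ a)
    (m : ℕ) :
    ordRes (iter φ m) = iterExponent d m * ordRes φ ↔
      IsNormalizedLift (iter φ m) (iterCoeffs a m) := by
  have hlift := isLift_iter (by omega) ha.1 m
  obtain ⟨s, hs0, hs⟩ := exists_ne_zero_and_forall_norm_le hlift.ne_zero
  have hpos : 2 * ((d ^ m : ℕ) : ℝ) ≠ 0 := by positivity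
  rw [ordRes_eq_sub hlift hs0 hs, ordRes_eq ha, ord_resForm_iterCoeffs hd ha.1.1, sub_eq_self,
    mul_eq_zero, or_iff_right hpos, ord_eq_zero_iff hs0, IsNormalizedLift, coe_iterCoeffs,
    and_iff_right hlift]
  simp only [← coe_iterCoeffs] at hs ⊢
  exact ⟨fun h => ⟨s, h⟩, fun ⟨t, ht⟩ =>
    le_antisymm (mem_integers_iff.1 (iterCoeffs a m s).2) (ht.ge.trans (hs t))⟩

lemma isNormalizedLift_iterCoeffs_iff (hd : 0 < d) {a : Coeffs d (Integers K)}
    (ha : IsNormalizedLift φ a) (m : ℕ) :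
    IsNormalizedLift (iter φ m) (iterCoeffs a m) ↔
      iterPair d (coordPoly (reduce a)) m ≠ 0 := by
  rw [isNormalizedLift_iff_reduce_ne_zero, coe_iterCoeffs, and_iff_right (isLift_iter hd ha.1 m),
    reduce_iterCoeffs, ← coordPoly_iterCoeffs]
  exact (coordPoly_injective.ne_iff' (funext fun i => by simp [coordPoly])).symm

end

end RatDyn

end

theorem proposition5p2_general {K : Type*} [NormedField K] [IsUltrametricDist K]
    (φ : RatFunc K) (d : ℕ) (hd : 2 ≤ d) (hφ : RatDyn.degree φ = d) (n : ℕ) (hn : 1 ≤ n)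
    (hss : RatDyn.HasSemistableReduction (RatDyn.iter φ n))
    (hR : RatDyn.ordRes (RatDyn.iter φ n) = RatDyn.iterExponent d n * RatDyn.ordRes φ) :
    RatDyn.HasSemistableReduction φ ∧
    (∃ r : ℝ, RatDyn.IsMinimalResultant φ r ∧
      RatDyn.IsMinimalResultant (RatDyn.iter φ n) (RatDyn.iterExponent d n * r)) ∧
    (2 ≤ n → ∀ m : ℕ,
      RatDyn.ordRes (RatDyn.iter φ m) = RatDyn.iterExponent d m * RatDyn.ordRes φ) := by
  have hd0 : 0 < d := by omega
  subst hφ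
  obtain ⟨a, ha⟩ := RatDyn.exists_isNormalizedLift φ
  have hn_norm := (RatDyn.ordRes_iter_eq_iff hd ha n).1 hR
  have hn_ss := hn_norm.isSemistable_reduce hss
  have hss' : RatDyn.IsSemistable (RatDyn.reduce a) :=
    .of_iterCoeffs (n := n) hd0 hn (by rwa [← RatDyn.reduce_iterCoeffs])
  refine ⟨⟨_, a, ha, hss'⟩, ⟨RatDyn.ordRes φ,
    RatDyn.isMinimalResultant_of_isSemistable hd0 ha hss', ?_⟩, fun h2 m => ?_⟩
  · rw [← hR]
    exact RatDyn.isMinimalResultant_of_isSemistable (pow_pos hd0 n) hn_norm hn_ss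
  · rw [RatDyn.ordRes_iter_eq_iff hd ha, RatDyn.isNormalizedLift_iterCoeffs_iff hd0 ha]
    rw [RatDyn.isNormalizedLift_iterCoeffs_iff hd0 ha] at hn_norm
    exact RatDyn.iterPair_ne_zero (RatDyn.natDegree_coordPoly_le _) h2 hn_norm m

theorem proposition5p2 {K : Type*} [NormedField K] [IsUltrametricDist K] [CompleteSpace K]
    [IsAlgClosed K] (φ : RatFunc K) (d : ℕ) (hd : 2 ≤ d) (hφ : RatDyn.degree φ = d)
    (n : ℕ) (hn : 1 ≤ n)
    (hss : RatDyn.HasSemistableReduction (RatDyn.iter φ n))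
    (hR : RatDyn.ordRes (RatDyn.iter φ n) = RatDyn.iterExponent d n * RatDyn.ordRes φ) :
    RatDyn.HasSemistableReduction φ ∧
    (∃ r : ℝ, RatDyn.IsMinimalResultant φ r ∧
      RatDyn.IsMinimalResultant (RatDyn.iter φ n) (RatDyn.iterExponent d n * r)) ∧
    (2 ≤ n → ∀ m : ℕ,
      RatDyn.ordRes (RatDyn.iter φ m) = RatDyn.iterExponent d m * RatDyn.ordRes φ) :=
  proposition5p2_general φ d hd hφ n hn hss hR
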